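/- Let $0<\epsilon<1$ and $r>0$ be constants, and let $\mathbb{G}=\mathbb{G}(n,p_2,p_3)$ be the random hypergraph on $n$ vertices in which every 2-element set of vertices is an edge with probability $p_2=\frac{1-\epsilon}{n}$ and every 3-element set of vertices is an edge with probability $p_3=\frac{r}{n\ln n}$, all independently ($n$ large enough for these to be probabilities). Put $\lambda(x)=1-\epsilon+rx$, $\lambda_1(x)=1-\epsilon+\frac r2x$, $$I_{\epsilon,r}=\int_0^{\epsilon/r}\bigl[1-\lambda(x)+\ln\lambda(x)\bigr]\,dx,\qquad K_0=\max\{1,\lambda_1^{-1}(10)\}.$$ The propagation process from a vertex $v$ keeps a set of active vertices, initially $\{v\}$, and a set of inactive vertices, initially empty. At each step, an active vertex $w$ is picked; every vertex $u$ that is neither active nor inactive becomes active if $\{w,u\}$ is an edge, or if $\{w,x,u\}$ is an edge for some inactive $x$; then $w$ becomes inactive. The process stops when there is no active vertex. Let $C_v$ be the set of vertices propagation connected from $v$, i.e. the smallest set containing $v$ that contains a vertex whenever it contains all the other vertices of some edge through it; the process stops after exactly $|C_v|$ steps, however the active vertices are picked. Call $v$ good if $|C_v|>K_0\ln n$, i.e.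 if the process from $v$ survives $K_0\ln n$ steps, and let $X$ be the number of good vertices. If $I_{\epsilon,r}>-1$, then, as $n\to\infty$, $$\Pr[X>0]=1-o(1);$$ moreover, for all distinct vertices $v_0,v_1$ (with $\Pr[v_0\text{ is good}]>0$ for all large $n$), $$\Pr[v_1\text{ is good}\mid v_0\text{ is good}]\le(1+o(1))\Pr[v_0\text{ is good}].$$ -/

import Mathlib

open MeasureTheory ProbabilityTheory Filter Topology
open scoped unitInterval

namespace PropagationConnectivity

/-! ### The random hypergraph -/

/-- A hypergraph on the vertex set `V` with 2-edges and 3-edges: the first component is the set of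
its 2-edges, the second one the set of its 3-edges. -/
abbrev MixedHypergraph (V : Type) : Type := Set (Finset V) × Set (Finset V)

/-- The law of `G(n, p₂, p₃)`: every 2-element set of vertices is a 2-edge with probability `p₂`,
every 3-element set of vertices is a 3-edge with probability `p₃`, all independently. -/
noncomputable def randomHypergraph (n : ℕ) (p₂ p₃ : I) : Measure (MixedHypergraph (Fin n)) :=
  (setBernoulli {e : Finset (Fin n) | e.card = 2} p₂).prod
    (setBernoulli {e : Finset (Fin n) | e.card = 3} p₃)

/-! ### Propagation -/

/-- `Reaches G v u`: the vertex `u` can be marked by propagation from `v`. The vertex `v` is marked,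
and a vertex is marked as soon as all the other vertices of some edge containing it are marked. -/
inductive Reaches {V : Type} [DecidableEq V] (G : MixedHypergraph V) (v : V) : V → Prop
  | start : Reaches G v v
  | two {a u : V} (ha : Reaches G v a) (he : {a, u} ∈ G.1) : Reaches G v u
  | three {a b u : V} (ha : Reaches G v a) (hb : Reaches G v b) (hab : a ≠ b)
      (he : {a, b, u} ∈ G.2) : Reaches G v u

/-- The component `C_v` of the vertices that are propagation connected from `v`. It is the set that
the step-by-step exploration process started at `v` has explored when it stops, and its size is the
number of steps of that process: see `explorationTime_eq_ncard_component` below. -/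
def component {V : Type} [DecidableEq V] (G : MixedHypergraph V) (v : V) : Set V :=
  {u | Reaches G v u}

/-- The vertex `v` is good for the constant `K`: `|C_v| > K ln n`, where `n` is the number of
vertices. -/
def IsGood {n : ℕ} (K : ℝ) (G : MixedHypergraph (Fin n)) (v : Fin n) : Prop :=
  K * Real.log n < ((component G v).ncard : ℝ)

/-- The number `X` of good vertices. -/
noncomputable def numGood {n : ℕ} (K : ℝ) (G : MixedHypergraph (Fin n)) : ℕ :=
  {v : Fin n | IsGood K G v}.ncard

/-- The event that the vertex `v` is good. -/
def goodEvent {n : ℕ} (K : ℝ) (v : Fin n) : Set (MixedHypergraph (Fin n)) :=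
  {G | IsGood K G v}

/-! ### The constants -/

/-- `λ(x) = 1 - ε + r x`. -/
def lam (ε r x : ℝ) : ℝ := 1 - ε + r * x

/-- `λ₁(x) = 1 - ε + (r / 2) x`. -/
noncomputable def lam₁ (ε r x : ℝ) : ℝ := 1 - ε + r / 2 * x

/-- `I_{ε,r} = ∫_0^{ε/r} (1 - λ(x) + ln λ(x)) dx`. -/
noncomputable def rateI (ε r : ℝ) : ℝ :=
  ∫ x in (0 : ℝ)..(ε / r), (1 - lam ε r x + Real.log (lam ε r x))

/-- The inverse function of `λ₁`, see `lam₁_eq_iff`. -/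
noncomputable def lam₁Inv (ε r y : ℝ) : ℝ := 2 * (y - (1 - ε)) / r

theorem lam₁_eq_iff {ε r x y : ℝ} (hr : 0 < r) : lam₁ ε r x = y ↔ x = lam₁Inv ε r y := by
  unfold lam₁ lam₁Inv
  rw [eq_div_iff hr.ne']
  constructor <;> intro h <;> linarith

/-- `K₀ = max {1, λ₁⁻¹(10)}`. -/
noncomputable def K₀ (ε r : ℝ) : ℝ := max 1 (lam₁Inv ε r 10)

/-! ### The exploration process

The process with its active and inactive vertices, and the fact that, whatever rule is used to pick
the active vertices, the process stops after exactly `|C_v|` steps with `C_v` explored. -/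

/-- The active and the inactive vertices at some time. -/
structure State (V : Type) where
  active : Finset V
  inactive : Finset V

open Classical in
/-- The unexplored vertices that become active when the active vertex `w` is processed. -/
noncomputable def newlyActive {V : Type} [DecidableEq V] [Fintype V] (G : MixedHypergraph V)
    (s : State V) (w : V) : Finset V :=
  Finset.univ.filter fun u => u ∉ s.active ∧ u ∉ s.inactive ∧
    ({w, u} ∈ G.1 ∨ ∃ x ∈ s.inactive, {w, x, u} ∈ G.2)

/-- One step of the process; `pick` chooses the active vertex to be processed. -/
noncomputable def step {V : Type} [DecidableEq V] [Fintype V] (pick : State V → V)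
    (G : MixedHypergraph V) (s : State V) : State V :=
  if s.active.Nonempty then
    { active := (s.active ∪ newlyActive G s (pick s)) \ {pick s}
      inactive := s.inactive ∪ {pick s} }
  else s

/-- The state of the process started at `v` at time `t`. -/
noncomputable def process {V : Type} [DecidableEq V] [Fintype V] (pick : State V → V)
    (G : MixedHypergraph V) (v : V) (t : ℕ) : State V :=
  (step pick G)^[t] { active := {v}, inactive := ∅ }

/-- The first time at which there is no active vertex. -/
noncomputable def explorationTime {V : Type} [DecidableEq V] [Fintype V] (pick : State V → V)
    (G : MixedHypergraph V) (v : V) : ℕ :=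
  sInf {t | (process pick G v t).active = ∅}

theorem process_invariant {V : Type} [DecidableEq V] [Fintype V] (pick : State V → V)
    (hpick : ∀ s : State V, s.active.Nonempty → pick s ∈ s.active)
    (G : MixedHypergraph V) (v : V) (t : ℕ) :
    Disjoint (process pick G v t).active (process pick G v t).inactive ∧
    (v ∈ (process pick G v t).active ∨ v ∈ (process pick G v t).inactive) ∧
    (∀ u, (u ∈ (process pick G v t).active ∨ u ∈ (process pick G v t).inactive) →
      Reaches G v u) ∧
    (∀ a ∈ (process pick G v t).inactive, ∀ u, {a, u} ∈ G.1 →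
      (u ∈ (process pick G v t).active ∨ u ∈ (process pick G v t).inactive)) ∧
    (∀ a ∈ (process pick G v t).inactive, ∀ b ∈ (process pick G v t).inactive, a ≠ b →
      ∀ u, {a, b, u} ∈ G.2 →
      (u ∈ (process pick G v t).active ∨ u ∈ (process pick G v t).inactive)) := by
  induction t with
  | zero =>
    refine ⟨by simp [process], by simp [process], ?_, by simp [process], by simp [process]⟩
    intro u hu
    have : u = v := by simpa [process] using hu
    subst this
    exact Reaches.start
  | succ t ih =>
    have hs : process pick G v (t + 1) = step pick G (process pick G v t) := by
      simp only [process, Function.iterate_succ_apply']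
    rw [hs]
    generalize process pick G v t = s at ih
    obtain ⟨h1, h2, h3, h4, h5⟩ := ih
    by_cases hne : s.active.Nonempty
    · have hp := hpick s hne
      have hpi : pick s ∉ s.inactive := Finset.disjoint_left.1 h1 hp
      have hst : step pick G s =
          { active := (s.active ∪ newlyActive G s (pick s)) \ {pick s}
            inactive := s.inactive ∪ {pick s} } := if_pos hne
      rw [hst]
      generalize hw : pick s = w at hp hpi
      have hnew : ∀ u, u ∈ newlyActive G s w ↔ (u ∉ s.active ∧ u ∉ s.inactive ∧
          ({w, u} ∈ G.1 ∨ ∃ x ∈ s.inactive, {w, x, u} ∈ G.2)) := by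
        intro u; simp [newlyActive]
      have hexp : ∀ u, (u ∈ s.active ∨ u ∈ s.inactive) ∨ u ∈ newlyActive G s w →
          (u ∈ (s.active ∪ newlyActive G s w) \ {w} ∨ u ∈ s.inactive ∪ {w}) := by
        intro u hu
        simp only [Finset.mem_sdiff, Finset.mem_union, Finset.mem_singleton]
        tauto
      have key : ∀ u, ({w, u} ∈ G.1 ∨ ∃ x ∈ s.inactive, {w, x, u} ∈ G.2) →
          (u ∈ s.active ∨ u ∈ s.inactive) ∨ u ∈ newlyActive G s w := by
        intro u hu
        rw [hnew]
        tauto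
      refine ⟨?_, hexp v (Or.inl h2), ?_, ?_, ?_⟩
      · rw [Finset.disjoint_left]
        intro u hu hu'
        simp only [Finset.mem_sdiff, Finset.mem_union, Finset.mem_singleton] at hu hu'
        rcases hu' with hu' | hu'
        · rcases hu.1 with h | h
          · exact Finset.disjoint_left.1 h1 h hu'
          · exact ((hnew u).1 h).2.1 hu'
        · exact hu.2 hu'
      · intro u hu
        simp only [Finset.mem_sdiff, Finset.mem_union, Finset.mem_singleton] at hu
        have hwR : Reaches G v w := h3 w (Or.inl hp)
        rcases hu with ⟨hu | hu, -⟩ | hu | hu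
        · exact h3 u (Or.inl hu)
        · rcases ((hnew u).1 hu).2.2 with h | ⟨x, hx, h⟩
          · exact Reaches.two hwR h
          · exact Reaches.three hwR (h3 x (Or.inr hx)) (fun e => hpi (e ▸ hx)) h
        · exact h3 u (Or.inr hu)
        · exact hu ▸ hwR
      · intro a ha u hu
        simp only [Finset.mem_union, Finset.mem_singleton] at ha
        rcases ha with ha | rfl
        · exact hexp u (Or.inl (h4 a ha u hu))
        · exact hexp u (key u (Or.inl hu))
      · intro a ha b hb hab u hu
        simp only [Finset.mem_union, Finset.mem_singleton] at ha hb
        rcases ha with ha | rfl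
        · rcases hb with hb | rfl
          · exact hexp u (Or.inl (h5 a ha b hb hab u hu))
          · refine hexp u (key u (Or.inr ⟨a, ha, ?_⟩))
            rwa [Finset.insert_comm]
        · rcases hb with hb | rfl
          · exact hexp u (key u (Or.inr ⟨b, hb, hu⟩))
          · exact absurd rfl hab
    · have hst : step pick G s = s := if_neg hne
      rw [hst]
      exact ⟨h1, h2, h3, h4, h5⟩

theorem process_card_inactive {V : Type} [DecidableEq V] [Fintype V] (pick : State V → V)
    (hpick : ∀ s : State V, s.active.Nonempty → pick s ∈ s.active)
    (G : MixedHypergraph V) (v : V) (t : ℕ)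
    (ht : ∀ t' < t, (process pick G v t').active.Nonempty) :
    (process pick G v t).inactive.card = t := by
  induction t with
  | zero => simp [process]
  | succ t ih =>
    have hs : process pick G v (t + 1) = step pick G (process pick G v t) := by
      simp only [process, Function.iterate_succ_apply']
    have ih' := ih fun t' h => ht t' (by omega)
    have hne := ht t (by omega)
    have hd := (process_invariant pick hpick G v t).1
    rw [hs]
    generalize process pick G v t = s at ih' hne hd
    have hpi : pick s ∉ s.inactive := Finset.disjoint_left.1 hd (hpick s hne)
    rw [step, if_pos hne]
    simp only
    rw [Finset.card_union_of_disjoint (by simpa using hpi), ih', Finset.card_singleton]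

/-- The process stops, and it does so after exactly `|C_v|` steps, when its set of inactive
vertices is `C_v`. -/
theorem explorationTime_eq_ncard_component {V : Type} [DecidableEq V] [Fintype V]
    (pick : State V → V) (hpick : ∀ s : State V, s.active.Nonempty → pick s ∈ s.active)
    (G : MixedHypergraph V) (v : V) :
    (process pick G v (explorationTime pick G v)).active = ∅ ∧
    ((process pick G v (explorationTime pick G v)).inactive : Set V) = component G v ∧
    explorationTime pick G v = (component G v).ncard := by
  have hex : {t | (process pick G v t).active = ∅}.Nonempty := by
    by_contra hcon
    have hall : ∀ t, (process pick G v t).active.Nonempty := by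
      intro t
      rw [Finset.nonempty_iff_ne_empty]
      exact fun h => hcon ⟨t, h⟩
    have hc := process_card_inactive pick hpick G v (Fintype.card V + 1) fun t' _ => hall t'
    have := Finset.card_le_univ (process pick G v (Fintype.card V + 1)).inactive
    omega
  have hT : (process pick G v (explorationTime pick G v)).active = ∅ := Nat.sInf_mem hex
  have hlt : ∀ t' < explorationTime pick G v, (process pick G v t').active.Nonempty := by
    intro t' h
    rw [Finset.nonempty_iff_ne_empty]
    exact fun h' => Nat.notMem_of_lt_sInf h h'
  have hcard := process_card_inactive pick hpick G v _ hlt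
  obtain ⟨-, h2, h3, h4, h5⟩ := process_invariant pick hpick G v (explorationTime pick G v)
  rw [hT] at h2 h3 h4 h5
  simp only [Finset.notMem_empty, false_or] at h2 h3 h4 h5
  have hset : ((process pick G v (explorationTime pick G v)).inactive : Set V) =
      component G v := by
    ext u
    refine ⟨fun hu => h3 u hu, fun hu => ?_⟩
    induction hu with
    | start => exact h2
    | two _ he iha => exact h4 _ iha _ he
    | three _ _ hab he iha ihb => exact h5 _ iha _ ihb hab _ he
  refine ⟨hT, hset, ?_⟩
  rw [← hset, Set.ncard_coe_finset, hcard]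

end PropagationConnectivity

namespace PropagationConnectivity

/-! ### The random hypergraph as a product measure -/

/-! Edges are revealed only when an exploration reads them, so events about unread edges stay
independent of the past (`DetBy.real_inter`). The theorem is a second moment argument whose two
halves use two different explorations.

Lower bound for P = Pr[v is good]. Let h = ⌈β ln n⌉ with β small. First h vertices are processed
singly, each activating exactly two vertices through 2-edges; such a step has probability bounded
below, so this phase costs only a factor n^(-O(β)). Then batches of h active vertices are processed,
each activating exactly h new vertices. When batch i = 0, 1, ... starts, (i+1)h vertices are
inactive, the number of newly activated vertices is binomial with mean about hλ(x), where x =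
min((i+1)β, ε/r), and it equals h with probability at least about n to the power β(1 - λ(x) + ln
λ(x)). Beyond (ε/r) ln n inactive vertices, further 3-edges are ignored: λ has reached 1, where the
rate is 0. Since the rate increases with x up to that point, these exponents form an upper Riemann
sum of I. With I > -1 this gives P ≥ n^(-1+c) for some c > 0, whatever the constant K
(`eventually_rpow_le_real_goodEvent`).

Upper bound for pairs. Explore from v by whole generations until more than t = ⌊K ln n⌋ vertices are
reached. Unless some degree is at least ⌈5 ln n⌉, which is negligibly likely, the reached set S has
polylogarithmic size. By symmetry another vertex w lies in S with conditional probability polylog/n.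
If w is outside S, its component in the hypergraph without S is independent of the exploration and
is contained in its component in G; if the former has at most t vertices and the latter more, an
unread edge must join the former to S, which has probability polylog/n. Hence Pr[both good] ≤ P(P +
polylog/n) up to a negligible term (`real_bigEvent_inter_le`), and P ≥ n^(-1+c) turns this into (1 +
o(1))P² (`joint_le_of_rpow_le`).

Dividing by P gives the conditional bound; Chebyshev's inequality with nP ≥ n^c gives X > 0 with
probability 1 - o(1) (`real_iInter_compl_le`). -/

/-- The indicator of the edges of `G`: 2-edges on the left, 3-edges on the right. -/
def HasEdge {V : Type} (G : MixedHypergraph V) : Finset V ⊕ Finset V → Prop :=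
  Sum.elim (· ∈ G.1) (· ∈ G.2)

@[simp] theorem hasEdge_inl {V : Type} (G : MixedHypergraph V) (e : Finset V) :
    HasEdge G (Sum.inl e) ↔ e ∈ G.1 := Iff.rfl

@[simp] theorem hasEdge_inr {V : Type} (G : MixedHypergraph V) (e : Finset V) :
    HasEdge G (Sum.inr e) ↔ e ∈ G.2 := Iff.rfl

/-- The hypergraph with given edge indicator. -/
def ofIndicator {V : Type} (ω : Finset V ⊕ Finset V → Prop) : MixedHypergraph V :=
  ({e | ω (Sum.inl e)}, {e | ω (Sum.inr e)})

@[simp] theorem hasEdge_ofIndicator {V : Type} (ω : Finset V ⊕ Finset V → Prop) :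
    HasEdge (ofIndicator ω) = ω := by
  funext i
  cases i <;> rfl

/-- The law of the indicator of a single edge. -/
noncomputable def edgeLaw {n : ℕ} (p₂ p₃ : I) : Finset (Fin n) ⊕ Finset (Fin n) → Measure Prop :=
  Sum.elim
    (fun e => unitInterval.toNNReal p₂ • Measure.dirac (e ∈ {e : Finset (Fin n) | e.card = 2}) +
      unitInterval.toNNReal (σ p₂) • Measure.dirac False)
    (fun e => unitInterval.toNNReal p₃ • Measure.dirac (e ∈ {e : Finset (Fin n) | e.card = 3}) +
      unitInterval.toNNReal (σ p₃) • Measure.dirac False)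

/-- The probability that a given potential edge is present. -/
noncomputable def edgeProb {n : ℕ} (p₂ p₃ : I) : Finset (Fin n) ⊕ Finset (Fin n) → ℝ :=
  Sum.elim (fun e => if e.card = 2 then (p₂ : ℝ) else 0)
    (fun e => if e.card = 3 then (p₃ : ℝ) else 0)

theorem edgeProb_nonneg {n : ℕ} (p₂ p₃ : I) (i : Finset (Fin n) ⊕ Finset (Fin n)) :
    0 ≤ edgeProb p₂ p₃ i := by
  cases i <;> simp only [edgeProb, Sum.elim_inl, Sum.elim_inr] <;> split_ifs <;>
    first | exact p₂.2.1 | exact p₃.2.1 | exact le_rfl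

instance isProbabilityMeasure_edgeLaw {n : ℕ} (p₂ p₃ : I)
    (i : Finset (Fin n) ⊕ Finset (Fin n)) : IsProbabilityMeasure (edgeLaw p₂ p₃ i) := by
  cases i <;> refine ⟨?_⟩ <;> simp [edgeLaw]

theorem edgeLaw_real_true {n : ℕ} (p₂ p₃ : I) (i : Finset (Fin n) ⊕ Finset (Fin n)) :
    (edgeLaw p₂ p₃ i).real {True} = edgeProb p₂ p₃ i := by
  cases i <;> simp [edgeLaw, edgeProb, measureReal_def] <;> split_ifs <;> simp_all

/-- Merges the two random edge sets into one product over a single finite index set, so that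
independence becomes a matter of disjoint sets of coordinates. Potential edges of the wrong size are
kept as coordinates that are almost surely false. -/
theorem randomHypergraph_eq_map (n : ℕ) (p₂ p₃ : I) :
    randomHypergraph n p₂ p₃ = (Measure.pi (edgeLaw (n := n) p₂ p₃)).map ofIndicator := by
  unfold randomHypergraph
  rw [setBernoulli_eq_map, setBernoulli_eq_map, Measure.infinitePi_eq_pi, Measure.infinitePi_eq_pi,
    Measure.map_prod_map _ _ .of_discrete .of_discrete]
  have h := (measurePreserving_sumPiEquivProdPi (edgeLaw (n := n) p₂ p₃)).map_eq
  simp only [edgeLaw, Sum.elim_inl, Sum.elim_inr] at h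
  rw [← h, Measure.map_map .of_discrete (MeasurableEquiv.measurable _)]
  rfl

instance isProbabilityMeasure_randomHypergraph (n : ℕ) (p₂ p₃ : I) :
    IsProbabilityMeasure (randomHypergraph n p₂ p₃) := by
  unfold randomHypergraph; infer_instance

theorem randomHypergraph_real_apply {n : ℕ} (p₂ p₃ : I) (A : Set (MixedHypergraph (Fin n))) :
    (randomHypergraph n p₂ p₃).real A =
      (Measure.pi (edgeLaw (n := n) p₂ p₃)).real (ofIndicator ⁻¹' A) := by
  rw [randomHypergraph_eq_map, map_measureReal_apply .of_discrete .of_discrete]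

/-- The event `A` depends only on the edges in `E`. -/
def DetBy {V : Type} (E : Set (Finset V ⊕ Finset V)) (A : Set (MixedHypergraph V)) : Prop :=
  ∀ G G' : MixedHypergraph V, (∀ i ∈ E, HasEdge G i ↔ HasEdge G' i) → G ∈ A → G' ∈ A

theorem DetBy.inter {V : Type} {E F : Set (Finset V ⊕ Finset V)} {A B : Set (MixedHypergraph V)}
    (hA : DetBy E A) (hB : DetBy F B) : DetBy (E ∪ F) (A ∩ B) :=
  fun G G' h hG => ⟨hA G G' (fun i hi => h i (Or.inl hi)) hG.1,
    hB G G' (fun i hi => h i (Or.inr hi)) hG.2⟩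

theorem DetBy.compl {V : Type} {E : Set (Finset V ⊕ Finset V)} {A : Set (MixedHypergraph V)}
    (hA : DetBy E A) : DetBy E Aᶜ :=
  fun G G' h hG hG' => hG (hA G' G (fun i hi => (h i hi).symm) hG')

theorem detBy_hasEdge {V : Type} (i : Finset V ⊕ Finset V) :
    DetBy {i} {G | HasEdge G i} :=
  fun _ _ h hG => (h i rfl).1 hG

/-- Events depending on disjoint sets of edges are independent. -/
theorem DetBy.real_inter {n : ℕ} (p₂ p₃ : I) {E F : Set (Finset (Fin n) ⊕ Finset (Fin n))}
    {A B : Set (MixedHypergraph (Fin n))} (hA : DetBy E A) (hB : DetBy F B) (hEF : Disjoint E F) :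
    (randomHypergraph n p₂ p₃).real (A ∩ B) =
      (randomHypergraph n p₂ p₃).real A * (randomHypergraph n p₂ p₃).real B := by
  classical
  rw [randomHypergraph_real_apply, randomHypergraph_real_apply, randomHypergraph_real_apply]
  have hind : iIndepFun (fun (i : Finset (Fin n) ⊕ Finset (Fin n))
      (ω : Finset (Fin n) ⊕ Finset (Fin n) → Prop) => ω i)
      (Measure.pi (edgeLaw (n := n) p₂ p₃)) :=
    iIndepFun_pi (X := fun _ => id) fun _ => aemeasurable_id
  have hd : Disjoint E.toFinset F.toFinset := by simpa using hEF
  have hi := hind.indepFun_finset E.toFinset F.toFinset hd fun i => measurable_pi_apply i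
  -- An event determined by `D` is the full preimage of its projection to the coordinates in `D`,
  -- which is the form that independence of coordinate blocks requires.
  have key : ∀ {D : Set (Finset (Fin n) ⊕ Finset (Fin n))} {C : Set (MixedHypergraph (Fin n))},
      DetBy D C → ofIndicator ⁻¹' C =
        (fun (ω : Finset (Fin n) ⊕ Finset (Fin n) → Prop) (i : D.toFinset) => ω i) ⁻¹'
          ((fun (ω : Finset (Fin n) ⊕ Finset (Fin n) → Prop) (i : D.toFinset) => ω i) ''
            (ofIndicator ⁻¹' C)) := by
    intro D C h
    ext ω
    refine ⟨fun hω => ⟨ω, hω, rfl⟩, ?_⟩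
    rintro ⟨ω', hω', he⟩
    refine h (ofIndicator ω') (ofIndicator ω) (fun i hi => ?_) hω'
    rw [hasEdge_ofIndicator, hasEdge_ofIndicator]
    have := congrFun he ⟨i, by simpa using hi⟩
    exact iff_of_eq this
  rw [Set.preimage_inter, key hA, key hB]
  simp only [measureReal_def]
  rw [hi.measure_inter_preimage_eq_mul _ _ .of_discrete .of_discrete, ENNReal.toReal_mul]

theorem real_hasEdge {n : ℕ} (p₂ p₃ : I) (i : Finset (Fin n) ⊕ Finset (Fin n)) :
    (randomHypergraph n p₂ p₃).real {G | HasEdge G i} = edgeProb p₂ p₃ i := by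
  rw [randomHypergraph_real_apply, ← edgeLaw_real_true,
    ← (measurePreserving_eval (edgeLaw (n := n) p₂ p₃) i).map_eq,
    map_measureReal_apply (measurable_pi_apply i) .of_discrete]
  congr 1
  ext ω
  simp

theorem real_not_hasEdge {n : ℕ} (p₂ p₃ : I) (i : Finset (Fin n) ⊕ Finset (Fin n)) :
    (randomHypergraph n p₂ p₃).real {G | ¬ HasEdge G i} = 1 - edgeProb p₂ p₃ i := by
  rw [← real_hasEdge p₂ p₃ i, ← probReal_compl_eq_one_sub .of_discrete]
  rfl

theorem detBy_forall {V : Type} {ι : Type*} (U : Finset ι)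
    (F : ι → Set (Finset V ⊕ Finset V)) (A : ι → Set (MixedHypergraph V))
    (h : ∀ u ∈ U, DetBy (F u) (A u)) :
    DetBy (⋃ u ∈ U, F u) {G | ∀ u ∈ U, G ∈ A u} := by
  intro G G' hG hA u hu
  exact h u hu G G' (fun i hi => hG i (Set.mem_biUnion hu hi)) (hA u hu)

/-- Independence of finitely many events depending on disjoint sets of edges. -/
theorem real_forall_mem {n : ℕ} (p₂ p₃ : I) {ι : Type*} (U : Finset ι)
    (F : ι → Set (Finset (Fin n) ⊕ Finset (Fin n))) (A : ι → Set (MixedHypergraph (Fin n)))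
    (h : ∀ u ∈ U, DetBy (F u) (A u))
    (hF : ∀ u ∈ U, ∀ u' ∈ U, u ≠ u' → Disjoint (F u) (F u')) :
    (randomHypergraph n p₂ p₃).real {G | ∀ u ∈ U, G ∈ A u} =
      ∏ u ∈ U, (randomHypergraph n p₂ p₃).real (A u) := by
  classical
  induction U using Finset.induction_on with
  | empty => simp
  | insert u U hu ih =>
    rw [Finset.prod_insert hu, ← ih (fun u' h' => h u' (Finset.mem_insert_of_mem h'))
      (fun a ha b hb => hF a (Finset.mem_insert_of_mem ha) b (Finset.mem_insert_of_mem hb)),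
      ← DetBy.real_inter p₂ p₃ (h u (Finset.mem_insert_self u U))
      (detBy_forall U F A fun u' h' => h u' (Finset.mem_insert_of_mem h'))]
    · congr 1
      ext G
      simp
    · simp only [Set.disjoint_iUnion_right]
      intro u' hu'
      exact hF u (Finset.mem_insert_self u U) u' (Finset.mem_insert_of_mem hu')
        (by rintro rfl; exact hu hu')

theorem real_forall_hasEdge {n : ℕ} (p₂ p₃ : I) (F : Finset (Finset (Fin n) ⊕ Finset (Fin n))) :
    (randomHypergraph n p₂ p₃).real {G | ∀ i ∈ F, HasEdge G i} = ∏ i ∈ F, edgeProb p₂ p₃ i := by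
  refine (real_forall_mem p₂ p₃ F (fun i => {i}) (fun i => {G | HasEdge G i})
    (fun i _ => detBy_hasEdge i) (fun i _ j _ hij => by simpa using hij)).trans ?_
  exact Finset.prod_congr rfl fun i _ => real_hasEdge p₂ p₃ i

theorem real_forall_not_hasEdge {n : ℕ} (p₂ p₃ : I)
    (F : Finset (Finset (Fin n) ⊕ Finset (Fin n))) :
    (randomHypergraph n p₂ p₃).real {G | ∀ i ∈ F, ¬ HasEdge G i} =
      ∏ i ∈ F, (1 - edgeProb p₂ p₃ i) := by
  refine (real_forall_mem p₂ p₃ F (fun i => {i}) (fun i => {G | ¬ HasEdge G i})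
    (fun i _ => (detBy_hasEdge i).compl) (fun i _ j _ hij => by simpa using hij)).trans ?_
  exact Finset.prod_congr rfl fun i _ => real_not_hasEdge p₂ p₃ i

/-- The event that the edges in `F` are met by `G`. -/
theorem detBy_exists_hasEdge {V : Type} (F : Finset (Finset V ⊕ Finset V)) :
    DetBy (F : Set (Finset V ⊕ Finset V)) {G | ∃ i ∈ F, HasEdge G i} := by
  rintro G G' h ⟨i, hi, hG⟩
  exact ⟨i, hi, (h i hi).1 hG⟩

theorem real_exists_hasEdge {n : ℕ} (p₂ p₃ : I)
    (F : Finset (Finset (Fin n) ⊕ Finset (Fin n))) :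
    (randomHypergraph n p₂ p₃).real {G | ∃ i ∈ F, HasEdge G i} =
      1 - ∏ i ∈ F, (1 - edgeProb p₂ p₃ i) := by
  rw [← real_forall_not_hasEdge, ← probReal_compl_eq_one_sub .of_discrete]
  congr 1
  ext G
  simp only [Set.mem_ofPred_eq, Set.mem_compl_iff, not_forall, not_not, exists_prop]

/-! ### Relabelling the vertices -/

/-- The action of a permutation on potential edges. -/
def relabelEdge {V : Type} (τ : Equiv.Perm V) : Finset V ⊕ Finset V ≃ Finset V ⊕ Finset V :=
  Equiv.sumCongr τ.finsetCongr τ.finsetCongr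

/-- The hypergraph `G` with its vertices relabelled: `e` is an edge of the new hypergraph iff `τ e`
is an edge of `G`. -/
def relabel {V : Type} (τ : Equiv.Perm V) (G : MixedHypergraph V) : MixedHypergraph V :=
  ofIndicator (HasEdge G ∘ relabelEdge τ)

@[simp] theorem mem_relabel_fst {V : Type} (τ : Equiv.Perm V) (G : MixedHypergraph V)
    (e : Finset V) : e ∈ (relabel τ G).1 ↔ e.map τ.toEmbedding ∈ G.1 := Iff.rfl

@[simp] theorem mem_relabel_snd {V : Type} (τ : Equiv.Perm V) (G : MixedHypergraph V)
    (e : Finset V) : e ∈ (relabel τ G).2 ↔ e.map τ.toEmbedding ∈ G.2 := Iff.rfl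

/-- The law of an edge indicator depends only on the kind and the cardinality of the edge, and a
permutation of the vertices preserves both; so it only permutes coordinates with equal laws. -/
theorem real_preimage_relabel {n : ℕ} (p₂ p₃ : I) (τ : Equiv.Perm (Fin n))
    (A : Set (MixedHypergraph (Fin n))) :
    (randomHypergraph n p₂ p₃).real (relabel τ ⁻¹' A) = (randomHypergraph n p₂ p₃).real A := by
  rw [randomHypergraph_real_apply, randomHypergraph_real_apply]
  have hlaw : ∀ i, edgeLaw (n := n) p₂ p₃ ((relabelEdge τ).symm i) = edgeLaw p₂ p₃ i := by
    intro i
    cases i <;> simp [edgeLaw, relabelEdge]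
  have hmp : MeasurePreserving
      (MeasurableEquiv.arrowCongr' (relabelEdge τ).symm (MeasurableEquiv.refl Prop))
      (Measure.pi (edgeLaw (n := n) p₂ p₃)) (Measure.pi (edgeLaw (n := n) p₂ p₃)) := by
    refine measurePreserving_arrowCongr' _ _ (relabelEdge τ).symm (MeasurableEquiv.refl Prop) ?_
    intro i
    rw [hlaw]
    exact MeasurePreserving.id _
  exact hmp.measureReal_preimage (s := ofIndicator ⁻¹' A)
    (MeasurableSet.of_discrete.nullMeasurableSet)

end PropagationConnectivity

namespace PropagationConnectivity

/-! ### Exploration in batches -/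

/-- The probability that a binomial random variable takes the value `m`. -/
noncomputable def binMass (N : ℕ) (q : ℝ) (m : ℕ) : ℝ := N.choose m * q ^ m * (1 - q) ^ (N - m)

theorem binMass_nonneg {N : ℕ} {q : ℝ} {m : ℕ} (h0 : 0 ≤ q) (h1 : q ≤ 1) : 0 ≤ binMass N q m := by
  have : 0 ≤ 1 - q := by linarith
  unfold binMass
  positivity

open Classical in
/-- If pairwise disjoint families of edges are each met with probability `q`, then the number of
families that are met is binomial. -/
theorem real_card_filter_exists_hasEdge {n : ℕ} (p₂ p₃ : I) {ι : Type*} (U : Finset ι)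
    (F : ι → Finset (Finset (Fin n) ⊕ Finset (Fin n))) (q : ℝ) (m : ℕ)
    (hF : ∀ u ∈ U, ∀ u' ∈ U, u ≠ u' → Disjoint (F u) (F u'))
    (hq : ∀ u ∈ U, ∏ i ∈ F u, (1 - edgeProb p₂ p₃ i) = 1 - q) :
    (randomHypergraph n p₂ p₃).real {G | (U.filter fun u => ∃ i ∈ F u, HasEdge G i).card = m} =
      binMass U.card q m := by
  -- Split according to the exact set `Z` of families that are met; each of the `U.card.choose m`
  -- possible sets has the same probability.
  have hset : {G : MixedHypergraph (Fin n) |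
      (U.filter fun u => ∃ i ∈ F u, HasEdge G i).card = m} =
      ⋃ Z ∈ U.powersetCard m, {G | (U.filter fun u => ∃ i ∈ F u, HasEdge G i) = Z} := by
    ext G
    simp
  rw [hset, measureReal_biUnion_finset]
  · have hZ : ∀ Z ∈ U.powersetCard m, (randomHypergraph n p₂ p₃).real
        {G | (U.filter fun u => ∃ i ∈ F u, HasEdge G i) = Z} = q ^ m * (1 - q) ^ (U.card - m) := by
      intro Z hZ
      obtain ⟨hZU, hZm⟩ := Finset.mem_powersetCard.1 hZ
      have hev : {G : MixedHypergraph (Fin n) | (U.filter fun u => ∃ i ∈ F u, HasEdge G i) = Z} =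
          {G | ∀ u ∈ U, G ∈ (if u ∈ Z then {G : MixedHypergraph (Fin n) | ∃ i ∈ F u, HasEdge G i}
            else {G | ∃ i ∈ F u, HasEdge G i}ᶜ)} := by
        ext G
        simp only [Set.mem_ofPred_eq, Finset.ext_iff, Finset.mem_filter]
        refine forall_congr' fun u => ?_
        by_cases hu : u ∈ Z
        · simp [hu, hZU hu]
        · simp [hu]
      rw [hev, real_forall_mem p₂ p₃ U (fun u => (F u : Set (Finset (Fin n) ⊕ Finset (Fin n))))]
      · have : ∀ u ∈ U, (randomHypergraph n p₂ p₃).real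
            (if u ∈ Z then {G : MixedHypergraph (Fin n) | ∃ i ∈ F u, HasEdge G i}
            else {G | ∃ i ∈ F u, HasEdge G i}ᶜ) = if u ∈ Z then q else 1 - q := by
          intro u hu
          split_ifs
          · rw [real_exists_hasEdge, hq u hu]; ring
          · rw [probReal_compl_eq_one_sub .of_discrete, real_exists_hasEdge, hq u hu]; ring
        rw [Finset.prod_congr rfl this, Finset.prod_ite, Finset.prod_const, Finset.prod_const,
          Finset.filter_mem_eq_inter, Finset.inter_eq_right.2 hZU, hZm,
          Finset.filter_notMem_eq_sdiff, Finset.card_sdiff_of_subset hZU, hZm]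
      · intro u _
        split_ifs
        · exact detBy_exists_hasEdge _
        · exact (detBy_exists_hasEdge _).compl
      · intro u hu u' hu' hne
        exact_mod_cast hF u hu u' hu' hne
    rw [Finset.sum_congr rfl hZ, Finset.sum_const, Finset.card_powersetCard, nsmul_eq_mul, binMass,
      mul_assoc]
  · intro Z _ Z' _ hne
    rw [Function.onFun, Set.disjoint_left]
    intro G hG hG'
    exact hne (hG.symm.trans hG')
  · exact fun _ _ => .of_discrete

/-- The edges with all but one vertex in `J`. -/
def exposed {V : Type} (J : Finset V) : Set (Finset V ⊕ Finset V) :=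
  {i | Sum.elim (fun e => ∃ a ∈ J, a ∈ e) (fun e => ∃ a ∈ J, ∃ b ∈ J, a ≠ b ∧ a ∈ e ∧ b ∈ e) i}

theorem exposed_mono {V : Type} {J J' : Finset V} (h : J ⊆ J') : exposed J ⊆ exposed J' := by
  rintro (e | e)
  · rintro ⟨a, ha, hae⟩
    exact ⟨a, h ha, hae⟩
  · rintro ⟨a, ha, b, hb, hab⟩
    exact ⟨a, h ha, b, h hb, hab⟩

/-- A subset of `A` of cardinality `k`. -/
noncomputable def subsetOfCard {V : Type} (k : ℕ) (A : Finset V) : Finset V :=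
  if h : k ≤ A.card then (Finset.exists_subset_card_eq h).choose else ∅

theorem subsetOfCard_subset {V : Type} (k : ℕ) (A : Finset V) : subsetOfCard k A ⊆ A := by
  unfold subsetOfCard
  split_ifs with h
  · exact (Finset.exists_subset_card_eq h).choose_spec.1
  · exact Finset.empty_subset A

theorem card_subsetOfCard {V : Type} {k : ℕ} {A : Finset V} (h : k ≤ A.card) :
    (subsetOfCard k A).card = k := by
  unfold subsetOfCard
  rw [dif_pos h]
  exact (Finset.exists_subset_card_eq h).choose_spec.2

/-- The count depends only on the predicate passed to `f`, and this predicate reads no edge outside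
the families `F u` with `u ∈ U`. -/
theorem detBy_card_filter {V : Type} (U : Finset V) (F : V → Finset (Finset V ⊕ Finset V)) (m : ℕ)
    (f : (V → Prop) → Finset V) :
    DetBy (⋃ u ∈ U, (F u : Set (Finset V ⊕ Finset V)))
      {G | (f fun u => u ∈ U ∧ ∃ i ∈ F u, HasEdge G i).card = m} := by
  rintro G G' h (hG : _ = m)
  rw [Set.mem_ofPred_eq, ← hG]
  congr 2
  funext u
  refine propext (and_congr_right fun hu => exists_congr fun i => and_congr_right fun hi => ?_)
  exact (h i (Set.mem_biUnion hu hi)).symm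

variable {V : Type} [DecidableEq V]

/-- The edges that make `u` active when the batch `B` is processed, where 3-edges are only used if
they meet `J`. -/
def batchEdges (B J : Finset V) (u : V) : Finset (Finset V ⊕ Finset V) :=
  B.image (fun w => Sum.inl {w, u}) ∪ (B ×ˢ J).image (fun w => Sum.inr {w.1, w.2, u})

theorem exists_batchEdges {B J : Finset V} {u : V} {P : Finset V ⊕ Finset V → Prop} :
    (∃ i ∈ batchEdges B J u, P i) ↔
      (∃ w ∈ B, P (Sum.inl {w, u})) ∨ ∃ w ∈ B, ∃ x ∈ J, P (Sum.inr {w, x, u}) := by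
  simp only [batchEdges, Finset.mem_union, Finset.mem_image, Finset.mem_product, Prod.exists]
  constructor
  · rintro ⟨i, ⟨w, hw, rfl⟩ | ⟨w, x, ⟨hw, hx⟩, rfl⟩, hi⟩
    · exact Or.inl ⟨w, hw, hi⟩
    · exact Or.inr ⟨w, hw, x, hx, hi⟩
  · rintro (⟨w, hw, h⟩ | ⟨w, hw, x, hx, h⟩)
    · exact ⟨_, Or.inl ⟨w, hw, rfl⟩, h⟩
    · exact ⟨_, Or.inr ⟨w, x, ⟨hw, hx⟩, rfl⟩, h⟩

/-- An edge in the family of `u` consists of `u` and vertices of `B` and `J`; as `u` is in neither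
set, a common edge of two families would force `u = u'`. -/
theorem disjoint_batchEdges {B J : Finset V} {u u' : V} (huB : u ∉ B) (huJ : u ∉ J)
    (h : u ≠ u') : Disjoint (batchEdges B J u) (batchEdges B J u') := by
  rw [Finset.disjoint_left]
  intro i hi hi'
  simp only [batchEdges, Finset.mem_union, Finset.mem_image, Finset.mem_product, Prod.exists]
    at hi hi'
  rcases hi with ⟨w, hw, rfl⟩ | ⟨w, x, ⟨hw, hx⟩, rfl⟩ <;>
    rcases hi' with ⟨w', hw', he⟩ | ⟨w', x', ⟨hw', hx'⟩, he⟩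
  · have : u ∈ ({w', u'} : Finset V) := by rw [Sum.inl.inj he]; simp
    simp only [Finset.mem_insert, Finset.mem_singleton] at this
    rcases this with rfl | rfl
    · exact huB hw'
    · exact h rfl
  · cases he
  · cases he
  · have : u ∈ ({w', x', u'} : Finset V) := by rw [Sum.inr.inj he]; simp
    simp only [Finset.mem_insert, Finset.mem_singleton] at this
    rcases this with rfl | rfl | rfl
    · exact huB hw'
    · exact huJ hx'
    · exact h rfl

/-- Disjointness of `B` and `J` makes the triples `{w, x, u}` genuine 3-sets that determine `(w,
x)`, so exactly `B.card` 2-edges and `B.card * J.card` 3-edges are counted. -/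
theorem prod_batchEdges {n : ℕ} (p₂ p₃ : I) {B J : Finset (Fin n)} {u : Fin n} (hBJ : Disjoint B J)
    (huB : u ∉ B) (huJ : u ∉ J) :
    ∏ i ∈ batchEdges B J u, (1 - edgeProb p₂ p₃ i) =
      (1 - (p₂ : ℝ)) ^ B.card * (1 - (p₃ : ℝ)) ^ (B.card * J.card) := by
  have hd : Disjoint (B.image (fun w => (Sum.inl {w, u} : Finset (Fin n) ⊕ Finset (Fin n))))
      ((B ×ˢ J).image (fun w => Sum.inr {w.1, w.2, u})) := by
    rw [Finset.disjoint_left]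
    intro i hi hi'
    obtain ⟨w, -, rfl⟩ := Finset.mem_image.1 hi
    obtain ⟨w, -, h⟩ := Finset.mem_image.1 hi'
    cases h
  rw [batchEdges, Finset.prod_union hd, Finset.prod_image, Finset.prod_image]
  · congr 1
    · rw [← Finset.prod_const]
      refine Finset.prod_congr rfl fun w hw => ?_
      have hwu : w ≠ u := by rintro rfl; exact huB hw
      simp [edgeProb, Finset.card_pair hwu]
    · rw [← Finset.card_product, ← Finset.prod_const]
      refine Finset.prod_congr rfl fun w hw => ?_
      obtain ⟨h1, h2⟩ := Finset.mem_product.1 hw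
      have hwu : w.1 ≠ u := by rintro h; exact huB (h ▸ h1)
      have hxu : w.2 ≠ u := by rintro h; exact huJ (h ▸ h2)
      have hwx : w.1 ≠ w.2 := fun h => Finset.disjoint_left.1 hBJ h1 (h ▸ h2)
      have hc : ({w.1, w.2, u} : Finset (Fin n)).card = 3 :=
        Finset.card_eq_three.2 ⟨w.1, w.2, u, hwx, hwu, hxu, rfl⟩
      simp [edgeProb, hc]
  · rintro ⟨w, x⟩ hw ⟨w', x'⟩ hw' he
    simp only [Finset.coe_product, Set.mem_prod, Finset.mem_coe] at hw hw'
    have he := Sum.inr.inj he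
    simp only at he
    have h1 : w ∈ ({w', x', u} : Finset (Fin n)) := by rw [← he]; simp
    have h2 : x ∈ ({w', x', u} : Finset (Fin n)) := by rw [← he]; simp
    simp only [Finset.mem_insert, Finset.mem_singleton] at h1 h2
    have := @Finset.disjoint_left _ B J
    grind
  · intro w hw w' hw' he
    have he := Sum.inl.inj he
    have h1 : w ∈ ({w', u} : Finset (Fin n)) := by rw [← he]; simp
    simp only [Finset.mem_insert, Finset.mem_singleton] at h1
    rcases h1 with h1 | rfl
    · exact h1
    · exact absurd hw huB

/-- The edges to be read are fresh: neither the active vertex `w` nor the new vertex `u` is in `J`,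
so a 2-edge has no vertex there and a 3-edge at most one, one short of being exposed. -/
theorem disjoint_exposed_batchEdges {A J B J' : Finset V} {u : V} (hAJ : Disjoint A J)
    (hB : B ⊆ A) (hu : u ∉ J) :
    Disjoint (exposed J) (batchEdges B J' u : Set (Finset V ⊕ Finset V)) := by
  rw [Set.disjoint_right]
  intro i hi he
  simp only [batchEdges, Finset.coe_union, Finset.coe_image, Set.mem_union, Set.mem_image,
    Finset.mem_coe, Finset.mem_product, Prod.exists] at hi
  rcases hi with ⟨w, hw, rfl⟩ | ⟨w, x, ⟨hw, hx⟩, rfl⟩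
  · obtain ⟨a, ha, hae⟩ := he
    simp only [Finset.mem_insert, Finset.mem_singleton] at hae
    rcases hae with rfl | rfl
    · exact Finset.disjoint_left.1 hAJ (hB hw) ha
    · exact hu ha
  · obtain ⟨a, ha, b, hb, hab, hae, hbe⟩ := he
    simp only [Finset.mem_insert, Finset.mem_singleton] at hae hbe
    have := Finset.disjoint_left.1 hAJ (hB hw)
    grind

variable [Fintype V]

open Classical in
/-- The vertices that become active in a sweep from the state `s = (active, inactive)`. -/
noncomputable def sweepNew (b j : ℕ) (G : MixedHypergraph V) (s : Finset V × Finset V) :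
    Finset V :=
  (Finset.univ \ (s.1 ∪ s.2)).filter fun u =>
    ∃ i ∈ batchEdges (subsetOfCard b s.1) (subsetOfCard j s.2) u, HasEdge G i

/-- The state `(active, inactive)` after `k` sweeps; the `k`-th sweep processes `b k` active
vertices, and uses 3-edges through `j k` inactive vertices. -/
noncomputable def sweep (b j : ℕ → ℕ) (G : MixedHypergraph V) (v : V) : ℕ → Finset V × Finset V
  | 0 => ({v}, ∅)
  | k + 1 =>
    ((sweep b j G v k).1 \ subsetOfCard (b k) (sweep b j G v k).1 ∪
        sweepNew (b k) (j k) G (sweep b j G v k),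
      (sweep b j G v k).2 ∪ subsetOfCard (b k) (sweep b j G v k).1)

theorem disjoint_sweep (b j : ℕ → ℕ) (G : MixedHypergraph V) (v : V) (k : ℕ) :
    Disjoint (sweep b j G v k).1 (sweep b j G v k).2 := by
  induction k with
  | zero => simp [sweep]
  | succ k ih =>
    simp only [sweep]
    rw [Finset.disjoint_left] at ih ⊢
    intro u hu hu'
    simp only [Finset.mem_union, Finset.mem_sdiff, sweepNew, Finset.mem_filter] at hu hu'
    have := @subsetOfCard_subset V (b k) (sweep b j G v k).1 u
    have := @ih u
    tauto

theorem reaches_sweep (b j : ℕ → ℕ) (G : MixedHypergraph V) (v : V) (k : ℕ) :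
    ∀ u ∈ (sweep b j G v k).1 ∪ (sweep b j G v k).2, Reaches G v u := by
  induction k with
  | zero =>
    intro u hu
    have : u = v := by simpa [sweep] using hu
    exact this ▸ Reaches.start
  | succ k ih =>
    have hd := disjoint_sweep b j G v k
    generalize hs : sweep b j G v k = s at ih hd
    intro u hu
    simp only [sweep, hs, Finset.mem_union, Finset.mem_sdiff] at hu
    rcases hu with (⟨hu, -⟩ | hu) | hu | hu
    · exact ih u (Finset.mem_union_left _ hu)
    · simp only [sweepNew, Finset.mem_filter] at hu
      replace hu := hu.2
      rcases exists_batchEdges.1 hu with ⟨w, hw, h⟩ | ⟨w, hw, x, hx, h⟩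
      · exact Reaches.two (ih w (Finset.mem_union_left _ (subsetOfCard_subset _ _ hw))) h
      · refine Reaches.three (ih w (Finset.mem_union_left _ (subsetOfCard_subset _ _ hw)))
          (ih x (Finset.mem_union_right _ (subsetOfCard_subset _ _ hx))) ?_ h
        rintro rfl
        exact Finset.disjoint_left.1 hd (subsetOfCard_subset _ _ hw) (subsetOfCard_subset _ _ hx)
    · exact ih u (Finset.mem_union_right _ hu)
    · exact ih u (Finset.mem_union_left _ (subsetOfCard_subset _ _ hu))

/-- The history of the sweeps is a function of the exposed edges: a batch that has been processed
belongs to the inactive set, so every edge consulted so far has all but one vertex there. -/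
theorem sweep_congr (b j : ℕ → ℕ) (G G' : MixedHypergraph V) (v : V) (k : ℕ)
    (h : ∀ i ∈ exposed (sweep b j G v k).2, HasEdge G i ↔ HasEdge G' i) :
    sweep b j G v k = sweep b j G' v k := by
  induction k with
  | zero => rfl
  | succ k ih =>
    have hk := ih fun i hi => h i (exposed_mono (by simp [sweep]) hi)
    have hd := disjoint_sweep b j G v k
    simp only [sweep] at h ⊢
    rw [← hk]
    have hnew : sweepNew (b k) (j k) G (sweep b j G v k) =
        sweepNew (b k) (j k) G' (sweep b j G v k) := by
      generalize sweep b j G v k = s at h hd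
      unfold sweepNew
      ext u
      simp only [Finset.mem_filter]
      refine and_congr_right fun _ => ?_
      rw [exists_batchEdges, exists_batchEdges]
      refine or_congr (exists_congr fun w => and_congr_right fun hw => h _ ?_)
        (exists_congr fun w => and_congr_right fun hw =>
          exists_congr fun x => and_congr_right fun hx => h _ ?_)
      · exact ⟨w, Finset.mem_union_right _ hw, by simp⟩
      · refine ⟨w, Finset.mem_union_right _ hw, x,
          Finset.mem_union_left _ (subsetOfCard_subset _ _ hx), ?_, by simp, by simp⟩
        rintro rfl
        exact Finset.disjoint_left.1 hd (subsetOfCard_subset _ _ hw) (subsetOfCard_subset _ _ hx)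
    rw [hnew]

theorem detBy_sweep (b j : ℕ → ℕ) (v : V) (k : ℕ) (s : Finset V × Finset V) :
    DetBy (exposed s.2) {G | sweep b j G v k = s} := by
  rintro G G' h (hG : sweep b j G v k = s)
  subst hG
  exact (sweep_congr b j G G' v k h).symm

/-- Deferred decisions: the event that the state is `s` reads only edges exposed by `s.2`, the next
batch reads none of those, and the families of distinct unexplored vertices are disjoint. The number
of new vertices is therefore binomial and independent of the past. -/
theorem real_sweep_step {n : ℕ} (p₂ p₃ : I) (b j : ℕ → ℕ) (v : Fin n) (k m : ℕ)
    (s : Finset (Fin n) × Finset (Fin n)) (hs : Disjoint s.1 s.2) (hb : b k ≤ s.1.card)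
    (hj : j k ≤ s.2.card) :
    (randomHypergraph n p₂ p₃).real
        {G | sweep b j G v k = s ∧ (sweepNew (b k) (j k) G s).card = m} =
      (randomHypergraph n p₂ p₃).real {G | sweep b j G v k = s} *
        binMass (n - (s.1.card + s.2.card))
          (1 - (1 - (p₂ : ℝ)) ^ b k * (1 - (p₃ : ℝ)) ^ (b k * j k)) m := by
  classical
  set U : Finset (Fin n) := Finset.univ \ (s.1 ∪ s.2)
  have hU : ∀ u ∈ U, u ∉ s.1 ∧ u ∉ s.2 := by
    intro u hu
    simpa [U, not_or] using hu
  have hcard : U.card = n - (s.1.card + s.2.card) := by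
    rw [Finset.card_sdiff_of_subset (Finset.subset_univ _), Finset.card_univ, Fintype.card_fin,
      Finset.card_union_of_disjoint hs]
  have hdet : DetBy (⋃ u ∈ U, (batchEdges (subsetOfCard (b k) s.1) (subsetOfCard (j k) s.2) u :
      Set (Finset (Fin n) ⊕ Finset (Fin n))))
      {G | (sweepNew (b k) (j k) G s).card = m} := by
    have := detBy_card_filter U
      (batchEdges (subsetOfCard (b k) s.1) (subsetOfCard (j k) s.2)) m
      (fun P => Finset.univ.filter P)
    convert this using 5 with G
    ext u
    simp [sweepNew, U]
  have hind := DetBy.real_inter p₂ p₃ (detBy_sweep b j v k s) hdet (by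
    simp only [Set.disjoint_iUnion_right]
    intro u hu
    exact disjoint_exposed_batchEdges hs (subsetOfCard_subset _ _) (hU u hu).2)
  have hnew := real_card_filter_exists_hasEdge p₂ p₃ U
    (batchEdges (subsetOfCard (b k) s.1) (subsetOfCard (j k) s.2))
    (1 - (1 - (p₂ : ℝ)) ^ b k * (1 - (p₃ : ℝ)) ^ (b k * j k)) m
    (fun u hu u' _ hne => disjoint_batchEdges
      (fun h => (hU u hu).1 (subsetOfCard_subset _ _ h))
      (fun h => (hU u hu).2 (subsetOfCard_subset _ _ h)) hne)
    (fun u hu => by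
      rw [prod_batchEdges p₂ p₃
        (hs.mono (subsetOfCard_subset _ _) (subsetOfCard_subset _ _))
        (fun h => (hU u hu).1 (subsetOfCard_subset _ _ h))
        (fun h => (hU u hu).2 (subsetOfCard_subset _ _ h)),
        card_subsetOfCard hb, card_subsetOfCard hj]
      ring)
  rw [hcard] at hnew
  rw [← hnew]
  convert hind using 4 <;> rfl

/-- A lower bound for the probability that the sweeps find prescribed numbers of vertices. -/
theorem prod_binMass_le_real_sweep {n : ℕ} (p₂ p₃ : I) (v : Fin n) (a s b j m : ℕ → ℕ) (T : ℕ)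
    (ha₀ : a 0 = 1) (hs₀ : s 0 = 0) (ha : ∀ k < T, a (k + 1) = a k - b k + m k)
    (hs : ∀ k < T, s (k + 1) = s k + b k) (hb : ∀ k < T, b k ≤ a k) (hj : ∀ k < T, j k ≤ s k) :
    ∏ k ∈ Finset.range T, binMass (n - (a k + s k))
        (1 - (1 - (p₂ : ℝ)) ^ b k * (1 - (p₃ : ℝ)) ^ (b k * j k)) (m k) ≤
      (randomHypergraph n p₂ p₃).real
        {G | (sweep b j G v T).1.card = a T ∧ (sweep b j G v T).2.card = s T} := by
  classical
  induction T with
  | zero => simp [sweep, ha₀, hs₀]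
  | succ T ih =>
    have ih' := ih (fun k hk => ha k (by omega)) (fun k hk => hs k (by omega))
      (fun k hk => hb k (by omega)) (fun k hk => hj k (by omega))
    rw [Finset.prod_range_succ]
    have hq₂ := p₂.2
    have hq₃ := p₃.2
    have h2 : 0 ≤ (1 - (p₂ : ℝ)) ^ b T ∧ (1 - (p₂ : ℝ)) ^ b T ≤ 1 :=
      ⟨pow_nonneg (by linarith [hq₂.2]) _, pow_le_one₀ (by linarith [hq₂.2]) (by linarith [hq₂.1])⟩
    have h3 : 0 ≤ (1 - (p₃ : ℝ)) ^ (b T * j T) ∧ (1 - (p₃ : ℝ)) ^ (b T * j T) ≤ 1 :=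
      ⟨pow_nonneg (by linarith [hq₃.2]) _, pow_le_one₀ (by linarith [hq₃.2]) (by linarith [hq₃.1])⟩
    have hmass : 0 ≤ binMass (n - (a T + s T))
        (1 - (1 - (p₂ : ℝ)) ^ b T * (1 - (p₃ : ℝ)) ^ (b T * j T)) (m T) :=
      binMass_nonneg (by nlinarith) (by nlinarith)
    refine (mul_le_mul_of_nonneg_right ih' hmass).trans ?_
    -- All states with the prescribed cardinalities have the same conditional probability of the
    -- next count, so it factors out of the sum over the states.
    set S : Finset (Finset (Fin n) × Finset (Fin n)) :=
      Finset.univ.filter fun x => Disjoint x.1 x.2 ∧ x.1.card = a T ∧ x.2.card = s T with hS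
    have hset : {G : MixedHypergraph (Fin n) |
        (sweep b j G v T).1.card = a T ∧ (sweep b j G v T).2.card = s T} =
        ⋃ x ∈ S, {G | sweep b j G v T = x} := by
      ext G
      simp [hS, disjoint_sweep]
    rw [hset, measureReal_biUnion_finset _ (fun _ _ => .of_discrete), Finset.sum_mul]
    · have hx : ∀ x ∈ S, (randomHypergraph n p₂ p₃).real {G | sweep b j G v T = x} *
          binMass (n - (a T + s T))
            (1 - (1 - (p₂ : ℝ)) ^ b T * (1 - (p₃ : ℝ)) ^ (b T * j T)) (m T) =
          (randomHypergraph n p₂ p₃).real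
            {G | sweep b j G v T = x ∧ (sweepNew (b T) (j T) G x).card = m T} := by
        intro x hx
        obtain ⟨-, hd, h1, h2⟩ := Finset.mem_filter.1 hx
        rw [real_sweep_step p₂ p₃ b j v T (m T) x hd (h1 ▸ hb T (by omega))
          (h2 ▸ hj T (by omega)), h1, h2]
      rw [Finset.sum_congr rfl hx, ← measureReal_biUnion_finset _ (fun _ _ => .of_discrete)]
      · refine measureReal_mono ?_
        refine Set.iUnion₂_subset fun x hx => ?_
        rintro G ⟨hG, hm⟩
        obtain ⟨-, hd, h1, h2⟩ := Finset.mem_filter.1 hx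
        simp only [Set.mem_ofPred_eq, sweep, hG]
        have hsub := subsetOfCard_subset (b T) x.1
        have hcb : (subsetOfCard (b T) x.1).card = b T :=
          card_subsetOfCard (h1 ▸ hb T (by omega))
        rw [Finset.card_union_of_disjoint, Finset.card_union_of_disjoint,
          Finset.card_sdiff_of_subset hsub, hcb, hm, h1, h2, ha T (by omega), hs T (by omega)]
        · exact ⟨rfl, rfl⟩
        · exact (hd.mono_left hsub).symm
        · rw [Finset.disjoint_left]
          intro u hu hu'
          simp only [sweepNew, Finset.mem_filter, Finset.mem_sdiff, Finset.mem_union] at hu hu'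
          tauto
      · intro x _ y _ hne
        rw [Function.onFun, Set.disjoint_left]
        rintro G ⟨hG, -⟩ ⟨hG', -⟩
        exact hne (hG.symm.trans hG')
    · intro x _ y _ hne
      rw [Function.onFun, Set.disjoint_left]
      intro G hG hG'
      exact hne (hG.symm.trans hG')

theorem card_sweep_le_ncard_component (b j : ℕ → ℕ) (G : MixedHypergraph V) (v : V) (k : ℕ) :
    (sweep b j G v k).1.card + (sweep b j G v k).2.card ≤ (component G v).ncard := by
  rw [← Finset.card_union_of_disjoint (disjoint_sweep b j G v k), ← Set.ncard_coe_finset]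
  exact Set.ncard_le_ncard (fun u hu => reaches_sweep b j G v k u hu) (Set.toFinite _)

end PropagationConnectivity

namespace PropagationConnectivity

/-! ### Binomial estimates -/

/-- The elementary half of Stirling's formula, h! ≤ e h (h/e)^h. The induction step is (h + 1) ln(1
+ 1/h) ≥ 1. -/
theorem log_factorial_le {h : ℕ} (hh : 0 < h) :
    Real.log (h.factorial) ≤ h * Real.log h - h + 1 + Real.log h := by
  induction h, hh using Nat.le_induction with
  | base => simp
  | succ h hh ih =>
    have h0 : (0 : ℝ) < h := by exact_mod_cast hh
    have h1 : 1 / ((h : ℝ) + 1) ≤ Real.log (h + 1) - Real.log h := by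
      rw [← Real.log_div (by positivity) (by positivity)]
      have := Real.one_sub_inv_le_log_of_pos (x := ((h : ℝ) + 1) / h) (by positivity)
      refine le_trans (le_of_eq ?_) this
      field_simp
      ring
    have h2 : 1 ≤ (Real.log (h + 1) - Real.log h) * (h + 1) := by
      rwa [div_le_iff₀ (by positivity)] at h1
    rw [Nat.factorial_succ, Nat.cast_mul, Real.log_mul (by positivity) (by positivity)]
    push_cast
    nlinarith

/-- A lower bound for binomial point probabilities. -/
theorem le_log_binMass {n N h : ℕ} {q : ℝ} (hq0 : 0 < q) (hq1 : q < 1) (hh : 0 < h) (hN : h < N)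
    (hn : N ≤ n) :
    h * Real.log (((N : ℝ) - h) * q / h) + h - 1 - Real.log h + n * Real.log (1 - q) ≤
      Real.log (binMass N q h) := by
  have hh' : (0 : ℝ) < h := by exact_mod_cast hh
  have hNh : (0 : ℝ) < (N : ℝ) - h := by
    have : (h : ℝ) < N := by exact_mod_cast hN
    linarith
  have hfac : (0 : ℝ) < h.factorial := by exact_mod_cast h.factorial_pos
  -- Each of the `h` factors N, N - 1, ..., N - h + 1 is at least N - h. Below, the exponent `N - h`
  -- of `1 - q` is enlarged to `n`, which costs nothing to leading order and simplifies the limit.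
  have h1 : ((N : ℝ) - h) ^ h / h.factorial ≤ N.choose h := by
    rw [div_le_iff₀ hfac]
    have : (N - h) ^ h ≤ N.choose h * h.factorial := by
      rw [mul_comm, ← Nat.descFactorial_eq_factorial_mul_choose]
      exact (Nat.pow_le_pow_left (by omega) h).trans (Nat.pow_sub_le_descFactorial N h)
    have h' : (((N - h : ℕ) : ℝ)) ^ h ≤ N.choose h * h.factorial := by exact_mod_cast this
    rwa [Nat.cast_sub hN.le] at h'
  have h2 : (1 - q) ^ n ≤ (1 - q) ^ (N - h) :=
    pow_le_pow_of_le_one (by linarith) (by linarith) (by omega)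
  have h3 : ((N : ℝ) - h) ^ h / h.factorial * q ^ h * (1 - q) ^ n ≤ binMass N q h := by
    unfold binMass
    have : 0 < 1 - q := by linarith
    gcongr
  have hpos : 0 < ((N : ℝ) - h) ^ h / h.factorial * q ^ h * (1 - q) ^ n := by
    have : 0 < 1 - q := by linarith
    positivity
  refine le_trans ?_ (Real.log_le_log hpos h3)
  have hq1' : 0 < 1 - q := by linarith
  have e1 : Real.log (((N : ℝ) - h) ^ h / h.factorial * q ^ h * (1 - q) ^ n) =
      h * Real.log ((N : ℝ) - h) - Real.log h.factorial + h * Real.log q +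
        n * Real.log (1 - q) := by
    rw [Real.log_mul (by positivity) (by positivity), Real.log_mul (by positivity) (by positivity),
      Real.log_div (by positivity) (by positivity), Real.log_pow, Real.log_pow, Real.log_pow]
  have e2 : Real.log (((N : ℝ) - h) * q / h) =
      Real.log ((N : ℝ) - h) + Real.log q - Real.log h := by
    rw [Real.log_div (by positivity) (by positivity), Real.log_mul (by positivity) (by positivity)]
  rw [e1, e2]
  have := log_factorial_le hh
  nlinarith

/-- Here p ≤ 1/2, so -ln(1 - p) ≤ p/(1 - p) ≤ 2p. -/
theorem exp_neg_two_le_one_sub_pow {n : ℕ} {p : ℝ} (hp0 : 0 ≤ p) (hp : p * n ≤ 1) (hn : 2 ≤ n) :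
    Real.exp (-2) ≤ (1 - p) ^ n := by
  have hn' : (2 : ℝ) ≤ n := by exact_mod_cast hn
  have hp2 : p ≤ 1 / 2 := by
    by_contra hcon
    push Not at hcon
    nlinarith
  have h1 : 0 < 1 - p := by linarith
  rw [← Real.exp_log h1, ← Real.exp_nat_mul, Real.exp_le_exp]
  have h2 := Real.one_sub_inv_le_log_of_pos h1
  have h3 : -(2 * p) ≤ 1 - (1 - p)⁻¹ := by
    have : (1 - p)⁻¹ ≤ 1 + 2 * p := by
      rw [inv_le_iff_one_le_mul₀ h1]
      nlinarith
    linarith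
  nlinarith

/-- The bound does not depend on `n`: as long as at least half of the vertices are unexplored, a
vertex activates exactly two others with probability bounded below. This prices the single-vertex
phase. -/
theorem le_binMass_two {n N : ℕ} {p κ : ℝ} (hκ : 0 ≤ κ) (hκ1 : κ ≤ 1) (hp : p = κ / n)
    (hn : 4 ≤ n) (hN : n ≤ 2 * N) (hNn : N ≤ n) :
    κ ^ 2 / 16 * Real.exp (-2) ≤ binMass N p 2 := by
  have hn' : (4 : ℝ) ≤ n := by exact_mod_cast hn
  have hp0 : 0 ≤ p := by rw [hp]; positivity
  have hpn : p * n = κ := by rw [hp]; field_simp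
  have hp1 : p ≤ 1 := by nlinarith
  have h1 := exp_neg_two_le_one_sub_pow hp0 (by rw [hpn]; exact hκ1) (by omega : 2 ≤ n)
  have h2 : (1 - p) ^ n ≤ (1 - p) ^ (N - 2) :=
    pow_le_pow_of_le_one (by linarith) (by linarith) (by omega)
  have hN' : (n : ℝ) ≤ 2 * N := by exact_mod_cast hN
  have h3 : (n : ℝ) ^ 2 / 16 ≤ N.choose 2 := by
    rw [Nat.cast_choose_two]
    nlinarith
  have h4 : κ ^ 2 / 16 ≤ N.choose 2 * p ^ 2 := by
    rw [← hpn]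
    nlinarith [sq_nonneg p]
  unfold binMass
  exact mul_le_mul h4 (h1.trans h2) (Real.exp_pos _).le (by positivity)

/-! ### The rate function -/

/-- The rate `1 - y + ln y`. -/
noncomputable def rate (y : ℝ) : ℝ := 1 - y + Real.log y

theorem rate_nonpos {y : ℝ} (hy : 0 < y) : rate y ≤ 0 := by
  have := Real.log_le_sub_one_of_pos hy
  unfold rate
  linarith

/-- ln(y/x) ≥ 1 - x/y = (y - x)/y ≥ y - x, because y ≤ 1. This monotonicity makes right endpoints
overestimate the integral. -/
theorem rate_mono {x y : ℝ} (hx : 0 < x) (hxy : x ≤ y) (hy : y ≤ 1) : rate x ≤ rate y := by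
  have hy0 : 0 < y := hx.trans_le hxy
  have h := Real.one_sub_inv_le_log_of_pos (x := y / x) (by positivity)
  rw [Real.log_div (by positivity) (by positivity), inv_div] at h
  have : y - x ≤ 1 - x / y := by
    rw [one_sub_div (by positivity), le_div_iff₀ hy0]
    nlinarith
  unfold rate
  linarith

/-- An upper Riemann sum for `rateI`. -/
theorem rateI_le_sum {ε r β : ℝ} (hε₀ : 0 < ε) (hε₁ : ε < 1) (hr : 0 < r) (hβ : 0 < β) (M : ℕ) :
    rateI ε r ≤ ∑ i ∈ Finset.range M, β * rate (lam ε r (min ((i + 1 : ℕ) * β) (ε / r))) := by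
  have hX : 0 < ε / r := by positivity
  set x : ℕ → ℝ := fun i => min (i * β) (ε / r) with hx
  have hlam : ∀ y ∈ Set.Icc 0 (ε / r), 0 < lam ε r y ∧ lam ε r y ≤ 1 := by
    rintro y ⟨h0, h1⟩
    rw [le_div_iff₀ hr] at h1
    unfold lam
    constructor <;> nlinarith
  have hcont : ContinuousOn (fun y => rate (lam ε r y)) (Set.Icc 0 (ε / r)) := by
    unfold rate
    refine ContinuousOn.add (by unfold lam; fun_prop) (ContinuousOn.log (by unfold lam; fun_prop) ?_)
    exact fun y hy => (hlam y hy).1.ne'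
  have hint : ∀ a b, 0 ≤ a → a ≤ b → b ≤ ε / r →
      IntervalIntegrable (fun y => rate (lam ε r y)) volume a b := by
    intro a b ha hab hb
    refine (hcont.mono ?_).intervalIntegrable
    rw [Set.uIcc_of_le hab]
    exact Set.Icc_subset_Icc ha hb
  have hx0 : ∀ i, 0 ≤ x i := fun i => le_min (by positivity) hX.le
  have hxX : ∀ i, x i ≤ ε / r := fun i => min_le_right _ _
  have hxm : ∀ i, x i ≤ x (i + 1) := fun i => by
    refine min_le_min_right _ ?_
    push_cast
    nlinarith
  have hpart : ∀ M : ℕ, (∫ y in (0 : ℝ)..(x M), rate (lam ε r y)) ≤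
      ∑ i ∈ Finset.range M, β * rate (lam ε r (x (i + 1))) := by
    intro M
    induction M with
    | zero => simp [hx, hX.le]
    | succ M ih =>
      rw [Finset.sum_range_succ, ← intervalIntegral.integral_add_adjacent_intervals
        (hint 0 (x M) le_rfl (hx0 M) (hxX M)) (hint _ _ (hx0 M) (hxm M) (hxX _))]
      refine add_le_add ih ?_
      have h1 : (∫ y in (x M)..(x (M + 1)), rate (lam ε r y)) ≤
          ∫ _ in (x M)..(x (M + 1)), rate (lam ε r (x (M + 1))) := by
        refine intervalIntegral.integral_mono_on (hxm M) (hint _ _ (hx0 M) (hxm M) (hxX _))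
          (by simp) ?_
        intro y hy
        have hyI : y ∈ Set.Icc 0 (ε / r) := ⟨(hx0 M).trans hy.1, hy.2.trans (hxX _)⟩
        refine rate_mono (hlam y hyI).1 ?_ (hlam _ ⟨hx0 _, hxX _⟩).2
        unfold lam
        nlinarith [hy.2]
      refine h1.trans (le_of_eq ?_)
      rw [intervalIntegral.integral_const, smul_eq_mul]
      -- A cell reaching beyond `ε / r` is cut off there, yet the sum gives it full width `β`. This
      -- is harmless: its right endpoint has λ = 1 and rate 0.
      rcases le_total (ε / r) ((M + 1 : ℕ) * β) with hc | hc
      · have : lam ε r (x (M + 1)) = 1 := by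
          simp only [hx, min_eq_right hc]
          unfold lam
          field_simp
          ring
        rw [this]
        simp [rate]
      · have hc' : (M : ℝ) * β ≤ ε / r := by
          refine le_trans ?_ hc
          push_cast
          nlinarith
        simp only [hx, min_eq_left hc, min_eq_left hc']
        push_cast
        ring
  refine le_trans ?_ (hpart M)
  have hI : rateI ε r = ∫ y in (0 : ℝ)..(ε / r), rate (lam ε r y) := rfl
  rw [hI, ← intervalIntegral.integral_add_adjacent_intervals
        (hint 0 (x M) le_rfl (hx0 M) (hxX M)) (hint _ _ (hx0 M) (hxX M) le_rfl)]
  -- If the grid stops before `ε / r`, the omitted part of the integral is nonpositive.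
  have h0 := intervalIntegral.integral_nonneg (μ := volume) (f := fun y => -rate (lam ε r y)) (hxX M)
    fun y hy => neg_nonneg.2 (rate_nonpos (hlam y ⟨(hx0 M).trans hy.1, hy.2⟩).1)
  rw [intervalIntegral.integral_neg] at h0
  linarith

/-! ### Asymptotics of the phases -/

theorem tendsto_log_natCast : Tendsto (fun n : ℕ => Real.log n) atTop atTop :=
  Real.tendsto_log_atTop.comp tendsto_natCast_atTop_atTop

theorem tendsto_log_div_natCast : Tendsto (fun n : ℕ => Real.log n / n) atTop (𝓝 0) :=
  (Real.isLittleO_log_id_atTop.tendsto_div_nhds_zero).comp tendsto_natCast_atTop_atTop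

theorem tendsto_ceil_mul_log_div {β : ℝ} (hβ : 0 ≤ β) :
    Tendsto (fun n : ℕ => (⌈β * Real.log n⌉₊ : ℝ) / Real.log n) atTop (𝓝 β) :=
  (tendsto_nat_ceil_mul_div_atTop hβ).comp tendsto_log_natCast

theorem tendsto_floor_mul_log_div {β : ℝ} (hβ : 0 ≤ β) :
    Tendsto (fun n : ℕ => (⌊β * Real.log n⌋₊ : ℝ) / Real.log n) atTop (𝓝 β) :=
  (tendsto_nat_floor_mul_div_atTop hβ).comp tendsto_log_natCast

/-- Asymptotics of the binomial lower bound when `h` and `-n ln(1-q)` are of order `ln n`. -/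
theorem tendsto_log_binMass_lower {β Λ : ℝ} (hβ : 0 < β) (hΛ : 0 < Λ) {h N : ℕ → ℕ} {q : ℕ → ℝ}
    (hh : Tendsto (fun n => (h n : ℝ) / Real.log n) atTop (𝓝 β))
    (hN : Tendsto (fun n => (N n : ℝ) / n) atTop (𝓝 1))
    (hq : Tendsto (fun n : ℕ => n * Real.log (1 - q n) / Real.log n) atTop (𝓝 (-(β * Λ))))
    (hNn : ∀ n, N n ≤ n) (hq1 : ∀ᶠ n in atTop, q n < 1) {η : ℝ} (hη : 0 < η) :
    ∀ᶠ n : ℕ in atTop, 0 < binMass (N n) (q n) (h n) ∧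
      (β * rate Λ - η) * Real.log n ≤ Real.log (binMass (N n) (q n) (h n)) := by
  have hL := tendsto_log_natCast
  have hLpos : ∀ᶠ n : ℕ in atTop, 0 < Real.log n := hL.eventually_gt_atTop 0
  have hnpos : ∀ᶠ n : ℕ in atTop, 0 < n := eventually_gt_atTop 0
  -- The quantity `y` is additive over the edges of a family, so its asymptotics are explicit; `q`
  -- is compared with it only at the end.
  set y : ℕ → ℝ := fun n => -Real.log (1 - q n) with hy
  have hny : Tendsto (fun n : ℕ => n * y n / Real.log n) atTop (𝓝 (β * Λ)) := by
    refine (neg_neg (β * Λ) ▸ hq.neg).congr fun n => ?_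
    simp only [hy]
    ring
  have hhpos : ∀ᶠ n in atTop, 0 < h n := by
    filter_upwards [hh.eventually (lt_mem_nhds hβ), hLpos] with n h1 h2
    rcases Nat.eq_zero_or_pos (h n) with h0 | h0
    · simp [h0] at h1
    · exact h0
  have hypos : ∀ᶠ n in atTop, 0 < y n := by
    filter_upwards [hny.eventually (lt_mem_nhds (mul_pos hβ hΛ)), hLpos, hnpos] with n h1 h2 h3
    have h3' : (0 : ℝ) < n := by exact_mod_cast h3
    by_contra hcon
    push Not at hcon
    exact absurd h1 (not_lt.2 (div_nonpos_of_nonpos_of_nonneg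
      (mul_nonpos_of_nonneg_of_nonpos h3'.le hcon) h2.le))
  have hy0 : Tendsto y atTop (𝓝 0) := by
    have := hny.mul tendsto_log_div_natCast
    rw [mul_zero] at this
    refine this.congr' ?_
    filter_upwards [hLpos, hnpos] with n h2 h3
    have h3' : (0 : ℝ) < n := by exact_mod_cast h3
    field_simp
  have hhn : Tendsto (fun n => (h n : ℝ) / n) atTop (𝓝 0) := by
    have := hh.mul tendsto_log_div_natCast
    rw [mul_zero] at this
    refine this.congr' ?_
    filter_upwards [hLpos] with n h2
    field_simp
  have hNh : Tendsto (fun n => ((N n : ℝ) - h n) / n) atTop (𝓝 1) := by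
    have := hN.sub hhn
    rw [sub_zero] at this
    refine this.congr fun n => ?_
    rw [sub_div]
  have hNhpos : ∀ᶠ n in atTop, h n < N n := by
    filter_upwards [hNh.eventually (lt_mem_nhds one_pos), hnpos] with n h1 h3
    have h3' : (0 : ℝ) < n := by exact_mod_cast h3
    rw [lt_div_iff₀ h3', zero_mul, sub_pos] at h1
    exact_mod_cast h1
  have hnyh : Tendsto (fun n : ℕ => n * y n / h n) atTop (𝓝 Λ) := by
    have := hny.div hh hβ.ne'
    rw [mul_div_cancel_left₀ _ hβ.ne'] at this
    refine this.congr' ?_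
    filter_upwards [hLpos, hhpos] with n h2 h3
    have h3' : (0 : ℝ) < h n := by exact_mod_cast h3
    simp only [Pi.div_apply]
    field_simp
  -- This is (N - h)q/h, the argument of the logarithm in `le_log_binMass`, with `q` replaced by its
  -- lower bound y/(1 + y).
  have hmain : Tendsto (fun n => ((N n : ℝ) - h n) / n * (n * y n / h n) / (1 + y n)) atTop
      (𝓝 Λ) := by
    have := (hNh.mul hnyh).div (tendsto_const_nhds.add hy0 : Tendsto (fun n => 1 + y n) atTop _)
      (by norm_num)
    rwa [one_mul, add_zero, div_one] at this
  have hlogh : Tendsto (fun n => Real.log (h n) / Real.log n) atTop (𝓝 0) := by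
    have hhtop : Tendsto (fun n => (h n : ℝ)) atTop atTop := by
      refine (hh.pos_mul_atTop hβ hL).congr' ?_
      filter_upwards [hLpos] with n h2
      field_simp
    have := ((Real.isLittleO_log_id_atTop.tendsto_div_nhds_zero).comp hhtop).mul hh
    rw [zero_mul] at this
    refine this.congr' ?_
    filter_upwards [hLpos, hhpos] with n h2 h3
    have h3' : (0 : ℝ) < h n := by exact_mod_cast h3
    simp only [Function.comp, id]
    field_simp
  have hinv : Tendsto (fun n : ℕ => 1 / Real.log n) atTop (𝓝 0) := hL.const_div_atTop 1
  have hlim : Tendsto (fun n : ℕ => (h n : ℝ) / Real.log n *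
      Real.log (((N n : ℝ) - h n) / n * (n * y n / h n) / (1 + y n)) + h n / Real.log n -
      1 / Real.log n - Real.log (h n) / Real.log n + n * Real.log (1 - q n) / Real.log n) atTop
      (𝓝 (β * rate Λ)) := by
    have := ((((hh.mul (hmain.log hΛ.ne')).add hh).sub hinv).sub hlogh).add hq
    convert this using 2
    unfold rate
    ring
  filter_upwards [hlim.eventually (lt_mem_nhds (show β * rate Λ - η < β * rate Λ by linarith)),
    hLpos, hnpos, hhpos, hypos, hNhpos, hq1, hmain.eventually (lt_mem_nhds hΛ)]
    with n h1 h2 h3 h4 h5 h6 h7 h8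
  have h3' : (0 : ℝ) < n := by exact_mod_cast h3
  have h4' : (0 : ℝ) < h n := by exact_mod_cast h4
  have h6' : (0 : ℝ) < (N n : ℝ) - h n := by
    have : (h n : ℝ) < N n := by exact_mod_cast h6
    linarith
  have hqe : 1 - q n = Real.exp (-y n) := by
    simp only [hy, neg_neg]
    rw [Real.exp_log (by linarith)]
  -- From 1 - q = exp(-y) ≤ 1/(1 + y).
  have hqy : y n / (1 + y n) ≤ q n := by
    have hexp : Real.exp (-y n) ≤ 1 / (1 + y n) := by
      rw [Real.exp_neg, ← one_div]
      exact one_div_le_one_div_of_le (by linarith) (by linarith [Real.add_one_le_exp (y n)])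
    have : y n / (1 + y n) = 1 - 1 / (1 + y n) := by field_simp; ring
    linarith
  have hq0 : 0 < q n := lt_of_lt_of_le (by positivity) hqy
  refine ⟨?_, ?_⟩
  · unfold binMass
    have : (0 : ℝ) < (N n).choose (h n) := by exact_mod_cast Nat.choose_pos h6.le
    have : 0 < 1 - q n := by linarith
    positivity
  refine le_trans ?_ (le_log_binMass hq0 h7 h4 h6 (hNn n))
  have harg : ((N n : ℝ) - h n) / n * (n * y n / h n) / (1 + y n) ≤
      ((N n : ℝ) - h n) * q n / h n := by
    have : ((N n : ℝ) - h n) / n * (n * y n / h n) / (1 + y n) =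
        ((N n : ℝ) - h n) * (y n / (1 + y n)) / h n := by field_simp
    rw [this]
    gcongr
  have hlog := Real.log_le_log h8 harg
  have h1' := mul_le_mul_of_nonneg_right h1.le h2.le
  refine h1'.trans ?_
  have : ((h n : ℝ) / Real.log n *
      Real.log (((N n : ℝ) - h n) / n * (n * y n / h n) / (1 + y n)) + h n / Real.log n -
      1 / Real.log n - Real.log (h n) / Real.log n + n * Real.log (1 - q n) / Real.log n) *
      Real.log n = h n * Real.log (((N n : ℝ) - h n) / n * (n * y n / h n) / (1 + y n)) + h n -
      1 - Real.log (h n) + n * Real.log (1 - q n) := by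
    field_simp
  rw [this]
  have := mul_le_mul_of_nonneg_left hlog h4'.le
  linarith

end PropagationConnectivity

namespace PropagationConnectivity

/-! ### The probability that a vertex is good: lower bound -/

theorem tendsto_mul_log_one_sub {f p : ℕ → ℝ} {κ : ℝ} (hf : Tendsto f atTop atTop)
    (hp : ∀ᶠ n in atTop, p n = κ / f n) :
    Tendsto (fun n => f n * Real.log (1 - p n)) atTop (𝓝 (-κ)) := by
  refine ((Real.tendsto_mul_log_one_add_div_atTop (-κ)).comp hf).congr' ?_
  filter_upwards [hp] with n hn
  simp only [Function.comp, hn]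
  congr 2
  ring

theorem tendsto_natCast_mul_log : Tendsto (fun n : ℕ => (n : ℝ) * Real.log n) atTop atTop :=
  tendsto_natCast_atTop_atTop.atTop_mul_atTop₀ tendsto_log_natCast

theorem eventually_lt_one_of_tendsto {f p : ℕ → ℝ} {κ : ℝ} (hf : Tendsto f atTop atTop)
    (hp : ∀ᶠ n in atTop, p n = κ / f n) : ∀ᶠ n in atTop, p n < 1 := by
  have : Tendsto (fun n => κ / f n) atTop (𝓝 0) := hf.const_div_atTop κ
  filter_upwards [hp, this.eventually (gt_mem_nhds one_pos)] with n h1 h2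
  rwa [h1]

/-- The size of a batch. -/
noncomputable def batchSize (β : ℝ) (n : ℕ) : ℕ := ⌈β * Real.log n⌉₊

/-- The number of inactive vertices used while processing the `i`-th batch. -/
noncomputable def usedInactive (ε r β : ℝ) (n i : ℕ) : ℕ :=
  min ((i + 1) * batchSize β n) ⌊ε / r * Real.log n⌋₊

theorem tendsto_usedInactive {ε r β : ℝ} (hε₀ : 0 < ε) (hr : 0 < r) (hβ : 0 < β) (i : ℕ) :
    Tendsto (fun n : ℕ => (usedInactive ε r β n i : ℝ) / Real.log n) atTop
      (𝓝 (min ((i + 1 : ℕ) * β) (ε / r))) := by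
  have h1 := (tendsto_ceil_mul_log_div hβ.le).const_mul ((i + 1 : ℕ) : ℝ)
  have h2 := tendsto_floor_mul_log_div (β := ε / r) (by positivity)
  refine (h1.min h2).congr' ?_
  filter_upwards [tendsto_log_natCast.eventually_gt_atTop 0] with n hn
  unfold usedInactive batchSize
  rw [← mul_div_assoc, min_div_div_right hn.le, Nat.cast_min, Nat.cast_mul]

/-- A batch of h ≈ β ln n vertices with j ≈ x ln n usable inactive vertices misses a given vertex
with probability (1 - p₂)^h (1 - p₃)^(hj), and -n times its logarithm is asymptotic to βλ(x) ln n.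
The inactive vertices include the h from the single-vertex phase, hence i + 1 in place of i. -/
theorem eventually_le_log_batch {ε r β : ℝ} (hε₀ : 0 < ε) (hε₁ : ε < 1) (hr : 0 < r) (hβ : 0 < β)
    {p₂ p₃ : ℕ → ℝ}
    (hp₂ : ∀ᶠ n : ℕ in atTop, p₂ n = (1 - ε) / n)
    (hp₃ : ∀ᶠ n : ℕ in atTop, p₃ n = r / (n * Real.log n)) (i : ℕ) {η : ℝ} (hη : 0 < η) :
    ∀ᶠ n : ℕ in atTop,
      0 < binMass (n - (batchSize β n + 1 + (i + 1) * batchSize β n))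
        (1 - (1 - p₂ n) ^ batchSize β n * (1 - p₃ n) ^ (batchSize β n * usedInactive ε r β n i))
        (batchSize β n) ∧
      (β * rate (lam ε r (min ((i + 1 : ℕ) * β) (ε / r))) - η) * Real.log n ≤
      Real.log (binMass (n - (batchSize β n + 1 + (i + 1) * batchSize β n))
        (1 - (1 - p₂ n) ^ batchSize β n * (1 - p₃ n) ^ (batchSize β n * usedInactive ε r β n i))
        (batchSize β n)) := by
  have hL := tendsto_log_natCast
  have hx : 0 ≤ min ((i + 1 : ℕ) * β) (ε / r) := le_min (by positivity) (by positivity)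
  have hh := tendsto_ceil_mul_log_div hβ.le
  have hp₂1 := eventually_lt_one_of_tendsto tendsto_natCast_atTop_atTop hp₂
  have hp₃1 := eventually_lt_one_of_tendsto tendsto_natCast_mul_log hp₃
  refine tendsto_log_binMass_lower hβ (by unfold lam; nlinarith) hh ?_ ?_ (fun n => Nat.sub_le _ _)
    ?_ hη
  · have hsmall : Tendsto (fun n : ℕ => ((batchSize β n + 1 + (i + 1) * batchSize β n : ℕ) : ℝ) / n)
        atTop (𝓝 0) := by
      have h1 := ((hh.const_mul ((i : ℝ) + 2)).add (hL.const_div_atTop 1)).mul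
        tendsto_log_div_natCast
      rw [mul_zero] at h1
      refine h1.congr' ?_
      filter_upwards [hL.eventually_gt_atTop 0, eventually_gt_atTop 0] with n hn hn0
      have hn0' : (0 : ℝ) < n := by exact_mod_cast hn0
      unfold batchSize
      push_cast
      field_simp
      ring
    have h2 : Tendsto (fun n : ℕ => 1 - ((batchSize β n + 1 + (i + 1) * batchSize β n : ℕ) : ℝ) / n)
        atTop (𝓝 1) := by simpa using hsmall.const_sub 1
    refine h2.congr' ?_
    filter_upwards [hsmall.eventually (gt_mem_nhds one_pos), eventually_gt_atTop 0] with n h1 hn0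
    have hn0' : (0 : ℝ) < n := by exact_mod_cast hn0
    rw [div_lt_one hn0'] at h1
    rw [Nat.cast_sub (by exact_mod_cast h1.le)]
    field_simp
  · have h2 := tendsto_mul_log_one_sub tendsto_natCast_atTop_atTop hp₂
    have h3 := tendsto_mul_log_one_sub tendsto_natCast_mul_log hp₃
    have h4 := (hh.mul h2).add ((hh.mul (tendsto_usedInactive hε₀ hr hβ i)).mul h3)
    have h5 : β * -(1 - ε) + β * min ((i + 1 : ℕ) * β) (ε / r) * -r =
        -(β * lam ε r (min ((i + 1 : ℕ) * β) (ε / r))) := by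
      unfold lam
      ring
    rw [h5] at h4
    refine h4.congr' ?_
    filter_upwards [hL.eventually_gt_atTop 0, hp₂1, hp₃1] with n hn h2 h3
    have h2' : 0 < 1 - p₂ n := by linarith
    have h3' : 0 < 1 - p₃ n := by linarith
    rw [sub_sub_cancel, Real.log_mul (by positivity) (by positivity), Real.log_pow, Real.log_pow]
    unfold batchSize
    push_cast
    field_simp
  · filter_upwards [hp₂1, hp₃1] with n h2 h3
    have h2' : 0 < 1 - p₂ n := by linarith
    have h3' : 0 < 1 - p₃ n := by linarith
    have : 0 < (1 - p₂ n) ^ batchSize β n *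
      (1 - p₃ n) ^ (batchSize β n * usedInactive ε r β n i) := by positivity
    linarith

/-- The exploration that first processes `h` vertices one by one, each activating two vertices, and
then `M` batches of `h` vertices, each activating `h` vertices. -/
theorem prod_phases_le_real_ncard_component {n : ℕ} (p₂ p₃ : I) (v : Fin n) (h M : ℕ)
    (J : ℕ → ℕ) (hJ : ∀ i, J i ≤ (i + 1) * h) :
    (∏ k ∈ Finset.range h, binMass (n - (1 + k + k)) (p₂ : ℝ) 2) *
      ∏ i ∈ Finset.range M, binMass (n - (h + 1 + (i + 1) * h))
        (1 - (1 - (p₂ : ℝ)) ^ h * (1 - (p₃ : ℝ)) ^ (h * J i)) h ≤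
    (randomHypergraph n p₂ p₃).real
      {G | h + 1 + (M + 1) * h ≤ (component G v).ncard} := by
  -- The sequences are, in order, the active and inactive counts, the batch sizes, the inactive
  -- vertices used and the newly activated vertices. Each of the first `h` sweeps raises the active
  -- count by one, using no 3-edges; from then on it stays at `h + 1`.
  have key := prod_binMass_le_real_sweep p₂ p₃ v
    (fun k => if k < h then 1 + k else h + 1)
    (fun k => if k < h then k else (k - h + 1) * h)
    (fun k => if k < h then 1 else h) (fun k => if k < h then 0 else J (k - h))
    (fun k => if k < h then 2 else h) (h + M) ?_ ?_ ?_ ?_ ?_ ?_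
  · rw [Finset.prod_range_add] at key
    refine le_trans (le_of_eq ?_) (key.trans (measureReal_mono ?_))
    · congr 1
      · refine Finset.prod_congr rfl fun k hk => ?_
        have hk' := Finset.mem_range.1 hk
        simp [hk']
      · refine Finset.prod_congr rfl fun k hk => ?_
        simp
    · rintro G ⟨h1, h2⟩
      have h3 := card_sweep_le_ncard_component (fun k => if k < h then 1 else h)
        (fun k => if k < h then 0 else J (k - h)) G v (h + M)
      rw [h1, h2] at h3
      simpa using h3
  · rcases Nat.eq_zero_or_pos h with rfl | hh
    · simp
    · simp [hh]
  · rcases Nat.eq_zero_or_pos h with rfl | hh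
    · simp
    · simp [hh]
  · intro k hk
    split_ifs <;> omega
  · intro k hk
    split_ifs with h1 h2 h2
    · rfl
    · omega
    · have : k + 1 = h := by omega
      subst this
      simp
    · have : k + 1 - h = k - h + 1 := by omega
      rw [this]
      ring
  · intro k hk
    split_ifs <;> omega
  · intro k hk
    split_ifs
    · omega
    · exact hJ _

/-- If `I > -1`, then the expected number of good vertices is at least a power of `n`. -/
theorem eventually_rpow_le_real_goodEvent {ε r K : ℝ} (hε₀ : 0 < ε) (hε₁ : ε < 1) (hr : 0 < r)
    (hK : 0 < K) (hI : -1 < rateI ε r) (p₂ p₃ : ℕ → I)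
    (hp₂ : ∀ᶠ n : ℕ in atTop, (p₂ n : ℝ) = (1 - ε) / n)
    (hp₃ : ∀ᶠ n : ℕ in atTop, (p₃ n : ℝ) = r / (n * Real.log n)) :
    ∃ c : ℝ, 0 < c ∧ ∀ᶠ n : ℕ in atTop, ∀ v : Fin n,
      (n : ℝ) ^ (-1 + c) ≤ (randomHypergraph n (p₂ n) (p₃ n)).real (goodEvent K v) := by
  set κ : ℝ := 1 - ε with hκ
  have hκ0 : 0 < κ := by linarith
  set c₀ : ℝ := κ ^ 2 / 16 * Real.exp (-2) with hc₀
  have hc₀0 : 0 < c₀ := by positivity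
  set γ : ℝ := rateI ε r + 1 with hγ
  have hγ0 : 0 < γ := by linarith
  set D : ℝ := |Real.log c₀| + 1 with hD
  have hD0 : 0 < D := by positivity
  -- Budget for the exponent: since h ≤ 2β ln n eventually, the first phase costs at most γ/4; `M`
  -- is chosen with Mβ ≥ K, so that enough vertices are found; `η` makes the total loss of the `M`
  -- batches at most γ/8. What remains is (γ - 1) - γ/4 - γ/8 ≥ -1 + γ/2.
  set β : ℝ := γ / (8 * D) with hβdef
  have hβ : 0 < β := by positivity
  set M : ℕ := ⌈K / β⌉₊ with hM
  set η : ℝ := γ / (8 * (M + 1)) with hηdef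
  have hη : 0 < η := by positivity
  have hL := tendsto_log_natCast
  have hh := tendsto_ceil_mul_log_div hβ.le
  refine ⟨γ / 2, by positivity, ?_⟩
  have hphase : ∀ᶠ n : ℕ in atTop, ∀ i ∈ Finset.range M, _ :=
    (Finset.eventually_all (Finset.range M)).2 fun i _ =>
      eventually_le_log_batch hε₀ hε₁ hr hβ hp₂ hp₃ i hη
  -- Keeps at least half of the vertices unexplored during the first phase, as `le_binMass_two`
  -- requires.
  have hhn : ∀ᶠ n : ℕ in atTop, 4 * (batchSize β n + 1) ≤ n := by
    have h1 := ((hh.const_mul 4).add (hL.const_div_atTop 4)).mul tendsto_log_div_natCast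
    rw [mul_zero] at h1
    filter_upwards [h1.eventually (gt_mem_nhds one_pos), hL.eventually_gt_atTop 0,
      eventually_gt_atTop 0] with n h1 hn hn0
    have hn0' : (0 : ℝ) < n := by exact_mod_cast hn0
    have h2 : (4 * (⌈β * Real.log n⌉₊ / Real.log n) + 4 / Real.log n) * (Real.log n / n) =
        (4 * (⌈β * Real.log n⌉₊ + 1)) / n := by field_simp
    rw [h2, div_lt_one hn0'] at h1
    unfold batchSize
    exact_mod_cast h1.le
  filter_upwards [hphase, hhn, hp₂, hL.eventually_gt_atTop 1,
    hh.eventually (gt_mem_nhds (show β < β + β by linarith))] with n hph hn hp hLn hhb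
  intro v
  have hn4 : 4 ≤ n := by omega
  have hn0 : (0 : ℝ) < n := by exact_mod_cast (by omega : 0 < n)
  set h := batchSize β n with hhdef
  have hsub : {G : MixedHypergraph (Fin n) | h + 1 + (M + 1) * h ≤ (component G v).ncard} ⊆
      goodEvent K v := by
    intro G hG
    have hG' : ((h + 1 + (M + 1) * h : ℕ) : ℝ) ≤ (component G v).ncard := by exact_mod_cast hG
    refine lt_of_lt_of_le ?_ hG'
    have h1 : β * Real.log n ≤ h := Nat.le_ceil _
    have h2 : K ≤ M * β := by
      have := Nat.le_ceil (K / β)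
      rwa [div_le_iff₀ hβ] at this
    push_cast
    have h3 : (M : ℝ) * (β * Real.log n) ≤ M * h := by gcongr
    have h4 : K * Real.log n ≤ M * β * Real.log n := by gcongr
    nlinarith [(Nat.cast_nonneg h : (0 : ℝ) ≤ h)]
  refine le_trans ?_ ((prod_phases_le_real_ncard_component (p₂ n) (p₃ n) v h M
    (usedInactive ε r β n) (fun i => min_le_left _ _)).trans (measureReal_mono hsub))
  have hfirst : c₀ ^ h ≤ ∏ k ∈ Finset.range h, binMass (n - (1 + k + k)) (p₂ n : ℝ) 2 := by
    rw [← Finset.card_range h, ← Finset.prod_const, Finset.card_range]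
    refine Finset.prod_le_prod (fun _ _ => hc₀0.le) fun k hk => ?_
    have := Finset.mem_range.1 hk
    exact le_binMass_two hκ0.le (by linarith) hp hn4 (by omega) (Nat.sub_le _ _)
  have hprod : 0 < ∏ i ∈ Finset.range M, binMass (n - (h + 1 + (i + 1) * h))
        (1 - (1 - (p₂ n : ℝ)) ^ h * (1 - (p₃ n : ℝ)) ^ (h * usedInactive ε r β n i)) h :=
    Finset.prod_pos fun i hi => (hph i hi).1
  refine le_trans ?_ (mul_le_mul_of_nonneg_right hfirst hprod.le)
  rw [← Real.log_le_log_iff (by positivity) (by positivity), Real.log_rpow hn0,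
    Real.log_mul (by positivity) hprod.ne', Real.log_pow,
    Real.log_prod fun i hi => (hph i hi).1.ne']
  have hsum : (rateI ε r - M * η) * Real.log n ≤ ∑ i ∈ Finset.range M,
      Real.log (binMass (n - (h + 1 + (i + 1) * h))
        (1 - (1 - (p₂ n : ℝ)) ^ h * (1 - (p₃ n : ℝ)) ^ (h * usedInactive ε r β n i)) h) := by
    refine le_trans ?_ (Finset.sum_le_sum fun i hi => (hph i hi).2)
    rw [← Finset.sum_mul]
    refine mul_le_mul_of_nonneg_right ?_ (by linarith)
    rw [Finset.sum_sub_distrib]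
    have := rateI_le_sum hε₀ hε₁ hr hβ M
    simp only [Finset.sum_const, Finset.card_range, nsmul_eq_mul]
    linarith
  have hstart : -(γ / 4) * Real.log n ≤ h * Real.log c₀ := by
    rw [div_lt_iff₀ (by linarith)] at hhb
    have h1 : -D ≤ Real.log c₀ := by
      have := neg_abs_le (Real.log c₀)
      linarith
    have h2 : (h : ℝ) * D ≤ (β + β) * Real.log n * D := by
      exact mul_le_mul_of_nonneg_right hhb.le hD0.le
    have h3 : (β + β) * Real.log n * D = γ / 4 * Real.log n := by
      rw [hβdef]
      field_simp
      ring
    have h4 := mul_le_mul_of_nonneg_left h1 (Nat.cast_nonneg h : (0 : ℝ) ≤ h)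
    linarith
  have hMη : M * η ≤ γ / 8 := by
    have : (M + 1) * η = γ / 8 := by
      rw [hηdef]
      field_simp
    nlinarith
  nlinarith

end PropagationConnectivity

namespace PropagationConnectivity

/-! ### Exploration by generations -/

section Generations

variable {V : Type} [DecidableEq V] [Fintype V]

open Classical in
/-- The vertices that complete an edge all of whose other vertices are in `S`. -/
noncomputable def nbrs (G : MixedHypergraph V) (S : Finset V) : Finset V :=
  Finset.univ.filter fun u =>
    (∃ a ∈ S, {a, u} ∈ G.1) ∨ ∃ a ∈ S, ∃ b ∈ S, a ≠ b ∧ {a, b, u} ∈ G.2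

theorem mem_nbrs {G : MixedHypergraph V} {S : Finset V} {u : V} :
    u ∈ nbrs G S ↔ (∃ a ∈ S, {a, u} ∈ G.1) ∨ ∃ a ∈ S, ∃ b ∈ S, a ≠ b ∧ {a, b, u} ∈ G.2 := by
  simp [nbrs]

/-- The pair (exposed vertices, reached vertices) after `k` generations of the exploration from `v`
that stops once more than `t` vertices are reached. -/
noncomputable def grow (t : ℕ) (G : MixedHypergraph V) (v : V) : ℕ → Finset V × Finset V
  | 0 => (∅, {v})
  | k + 1 =>
    if (grow t G v k).2.card ≤ t then
      ((grow t G v k).2, (grow t G v k).2 ∪ nbrs G (grow t G v k).2)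
    else grow t G v k

theorem grow_fst_subset_snd (t : ℕ) (G : MixedHypergraph V) (v : V) (k : ℕ) :
    (grow t G v k).1 ⊆ (grow t G v k).2 := by
  induction k with
  | zero => simp [grow]
  | succ k ih =>
    rw [grow]
    split_ifs
    · exact Finset.subset_union_left
    · exact ih

theorem grow_fst_mono (t : ℕ) (G : MixedHypergraph V) (v : V) (k : ℕ) :
    (grow t G v k).1 ⊆ (grow t G v (k + 1)).1 := by
  rw [grow]
  split_ifs
  · exact grow_fst_subset_snd t G v k
  · rfl

theorem card_grow_fst_le (t : ℕ) (G : MixedHypergraph V) (v : V) (k : ℕ) :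
    (grow t G v k).1.card ≤ t := by
  induction k with
  | zero => simp [grow]
  | succ k ih =>
    rw [grow]
    split_ifs with h
    · exact h
    · exact ih

theorem nbrs_grow_fst_subset (t : ℕ) (G : MixedHypergraph V) (v : V) (k : ℕ) :
    nbrs G (grow t G v k).1 ⊆ (grow t G v k).2 := by
  induction k with
  | zero =>
    intro u hu
    simp [grow, mem_nbrs] at hu
  | succ k ih =>
    rw [grow]
    split_ifs
    · exact Finset.subset_union_right
    · exact ih

/-- Apart from `v`, every reached vertex is exposed or a neighbour of the exposed set, which has at
most `t` vertices. Degree bounds thus control how far the last generation overshoots `t`. -/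
theorem grow_snd_subset (t : ℕ) (G : MixedHypergraph V) (v : V) (k : ℕ) :
    (grow t G v k).2 ⊆ {v} ∪ (grow t G v k).1 ∪ nbrs G (grow t G v k).1 := by
  induction k with
  | zero => simp [grow]
  | succ k ih =>
    rw [grow]
    split_ifs
    · exact Finset.union_subset_union_left Finset.subset_union_right
    · exact ih

theorem reaches_grow (t : ℕ) (G : MixedHypergraph V) (v : V) (k : ℕ) :
    ∀ u ∈ (grow t G v k).2, Reaches G v u := by
  induction k with
  | zero =>
    intro u hu
    have : u = v := by simpa [grow] using hu
    exact this ▸ Reaches.start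
  | succ k ih =>
    rw [grow]
    split_ifs
    · intro u hu
      rcases Finset.mem_union.1 hu with hu | hu
      · exact ih u hu
      · rcases mem_nbrs.1 hu with ⟨a, ha, h⟩ | ⟨a, ha, b, hb, hab, h⟩
        · exact Reaches.two (ih a ha) h
        · exact Reaches.three (ih a ha) (ih b hb) hab h
    · exact ih

theorem mem_grow_snd (t : ℕ) (G : MixedHypergraph V) (v : V) (k : ℕ) : v ∈ (grow t G v k).2 := by
  induction k with
  | zero => simp [grow]
  | succ k ih =>
    rw [grow]
    split_ifs
    · exact Finset.mem_union_left _ ih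
    · exact ih

/-- A generation that neither has passed the threshold nor is closed under propagation gains at
least one vertex. Therefore `Fintype.card V` generations always suffice to settle whether the
component has more than `t` vertices. -/
theorem grow_progress (t : ℕ) (G : MixedHypergraph V) (v : V) (k : ℕ) :
    t < (grow t G v k).2.card ∨ nbrs G (grow t G v k).2 ⊆ (grow t G v k).2 ∨
      k + 1 ≤ (grow t G v k).2.card := by
  induction k with
  | zero => simp [grow]
  | succ k ih =>
    rw [grow]
    split_ifs with h
    · by_cases hsub : nbrs G (grow t G v k).2 ⊆ (grow t G v k).2
      · right; left
        rwa [Finset.union_eq_left.2 hsub]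
      · right; right
        have hk : k + 1 ≤ (grow t G v k).2.card := by
          rcases ih with h1 | h1 | h1
          · omega
          · exact absurd h1 hsub
          · exact h1
        have hss : (grow t G v k).2 ⊂ (grow t G v k).2 ∪ nbrs G (grow t G v k).2 :=
          Finset.ssubset_iff_subset_ne.2 ⟨Finset.subset_union_left, fun he =>
            hsub (Finset.union_eq_left.1 he.symm)⟩
        have := Finset.card_lt_card hss
        simp only
        omega
    · exact Or.inl (not_le.1 h)

/-- The final state of the exploration by generations. -/
noncomputable def explored (t : ℕ) (G : MixedHypergraph V) (v : V) : Finset V × Finset V :=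
  grow t G v (Fintype.card V)

theorem lt_ncard_component_iff (t : ℕ) (G : MixedHypergraph V) (v : V) :
    t < (component G v).ncard ↔ t < (explored t G v).2.card := by
  have hsub : ((explored t G v).2 : Set V) ⊆ component G v :=
    fun u hu => reaches_grow t G v _ u hu
  constructor
  · intro h
    rcases grow_progress t G v (Fintype.card V) with h1 | h1 | h1
    · exact h1
    · refine h.trans_le ?_
      rw [← Set.ncard_coe_finset]
      refine Set.ncard_le_ncard ?_ (Set.toFinite _)
      intro u (hu : Reaches G v u)
      induction hu with
      | start => exact mem_grow_snd t G v _
      | two _ he iha => exact h1 (mem_nbrs.2 (Or.inl ⟨_, iha, he⟩))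
      | three _ _ hab he iha ihb => exact h1 (mem_nbrs.2 (Or.inr ⟨_, iha, _, ihb, hab, he⟩))
    · have := Finset.card_le_univ (grow t G v (Fintype.card V)).2
      omega
  · intro h
    rw [← Set.ncard_coe_finset] at h
    exact h.trans_le (Set.ncard_le_ncard hsub (Set.toFinite _))

/-- A generation is computed from the edges exposed by the set it expands, and that set becomes the
first component. The final overshooting generation is reached but not expanded, so its further edges
remain unread. -/
theorem grow_congr (t : ℕ) (G G' : MixedHypergraph V) (v : V) (k : ℕ)
    (h : ∀ i ∈ exposed (grow t G v k).1, HasEdge G i ↔ HasEdge G' i) :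
    grow t G v k = grow t G' v k := by
  induction k with
  | zero => rfl
  | succ k ih =>
    have hk := ih fun i hi => h i (exposed_mono (grow_fst_mono t G v k) hi)
    rw [grow] at h ⊢
    rw [grow, ← hk]
    split_ifs at h ⊢ with hc
    · have : nbrs G (grow t G v k).2 = nbrs G' (grow t G v k).2 := by
        ext u
        rw [mem_nbrs, mem_nbrs]
        refine or_congr (exists_congr fun a => and_congr_right fun ha => ?_)
          (exists_congr fun a => and_congr_right fun ha => exists_congr fun b =>
            and_congr_right fun hb => and_congr_right fun hab => ?_)
        · exact h (Sum.inl {a, u}) ⟨a, ha, by simp⟩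
        · exact h (Sum.inr {a, b, u}) ⟨a, ha, b, hb, hab, by simp, by simp⟩
      rw [this]
    · rfl

theorem detBy_explored (t : ℕ) (v : V) (x : Finset V × Finset V) :
    DetBy (exposed x.1) {G | explored t G v = x} := by
  rintro G G' h (hG : explored t G v = x)
  subst hG
  exact (grow_congr t G G' v _ h).symm

theorem nbrs_map (τ : Equiv.Perm V) (G : MixedHypergraph V) (S : Finset V) :
    nbrs G (S.map τ.toEmbedding) = (nbrs (relabel τ G) S).map τ.toEmbedding := by
  ext u
  obtain ⟨u, rfl⟩ := τ.surjective u
  simp [mem_nbrs, -Finset.mem_map_equiv, Finset.map_insert]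

/-- Expanding whole generations involves no choice of a vertex or subset, so this exploration,
unlike the sweeps, commutes with relabelling. The symmetry arguments for pairs depend on this. -/
theorem grow_relabel (t : ℕ) (τ : Equiv.Perm V) (G : MixedHypergraph V) (v : V) (k : ℕ) :
    grow t G (τ v) k = ((grow t (relabel τ G) v k).1.map τ.toEmbedding,
      (grow t (relabel τ G) v k).2.map τ.toEmbedding) := by
  induction k with
  | zero => simp [grow]
  | succ k ih =>
    rw [grow, grow, ih]
    simp only [Finset.card_map]
    split_ifs
    · rw [nbrs_map, Finset.map_union]
    · rfl

end Generations

/-! ### Restriction to the complement of a set of vertices -/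

/-- The edges disjoint from `S`. -/
def avoiding {V : Type} (S : Finset V) : Set (Finset V ⊕ Finset V) :=
  {i | Sum.elim (fun e => Disjoint e S) (fun e => Disjoint e S) i}

/-- The hypergraph of the edges of `G` that are disjoint from `S`. -/
def restrictTo {V : Type} (G : MixedHypergraph V) (S : Finset V) : MixedHypergraph V :=
  ({e | e ∈ G.1 ∧ Disjoint e S}, {e | e ∈ G.2 ∧ Disjoint e S})

theorem restrictTo_congr {V : Type} {G G' : MixedHypergraph V} {S : Finset V}
    (h : ∀ i ∈ avoiding S, HasEdge G i ↔ HasEdge G' i) : restrictTo G S = restrictTo G' S := by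
  refine Prod.ext ?_ ?_
  · ext e
    exact and_congr_left fun hd => h (Sum.inl e) hd
  · ext e
    exact and_congr_left fun hd => h (Sum.inr e) hd

theorem detBy_restrictTo {V : Type} (S : Finset V) (P : MixedHypergraph V → Prop) :
    DetBy (avoiding S) {G | P (restrictTo G S)} := by
  intro G G' h hG
  rw [Set.mem_ofPred_eq, ← restrictTo_congr h]
  exact hG

/-- Every exposed edge meets `J`. Hence, once the exploration has read edges through the exposed
set, the hypergraph outside the reached set is still untouched. -/
theorem disjoint_exposed_avoiding {V : Type} {J S : Finset V} (h : J ⊆ S) :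
    Disjoint (exposed J) (avoiding S) := by
  rw [Set.disjoint_left]
  rintro (e | e) he hd
  · obtain ⟨a, ha, hae⟩ := he
    exact Finset.disjoint_left.1 hd hae (h ha)
  · obtain ⟨a, ha, b, -, -, hae, -⟩ := he
    exact Finset.disjoint_left.1 hd hae (h ha)

section Restriction

variable {V : Type} [DecidableEq V]

theorem component_restrictTo_subset (G : MixedHypergraph V) (S : Finset V) (v : V) :
    component (restrictTo G S) v ⊆ component G v := by
  intro u (hu : Reaches _ v u)
  induction hu with
  | start => exact Reaches.start
  | two _ he iha => exact Reaches.two iha he.1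
  | three _ _ hab he iha ihb => exact Reaches.three iha ihb hab he.1

theorem notMem_of_reaches_restrictTo {G : MixedHypergraph V} {S : Finset V} {v u : V} (hv : v ∉ S)
    (hu : Reaches (restrictTo G S) v u) : u ∉ S := by
  cases hu with
  | start => exact hv
  | two _ he => exact Finset.disjoint_left.1 he.2 (by simp)
  | three _ _ _ he => exact Finset.disjoint_left.1 he.2 (by simp)

/-- If the component of `v` becomes smaller when `S` is deleted, then some edge leads from the
smaller component to `S`. -/
theorem exists_edge_of_ncard_lt [Finite V] {G : MixedHypergraph V} {S : Finset V} {v : V} (hv : v ∉ S)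
    (h : (component (restrictTo G S) v).ncard < (component G v).ncard) :
    (∃ a ∈ component (restrictTo G S) v, ∃ u ∈ S, {a, u} ∈ G.1) ∨
      ∃ a ∈ component (restrictTo G S) v, ∃ b ∈ component (restrictTo G S) v, a ≠ b ∧
        ∃ u ∈ S, {a, b, u} ∈ G.2 := by
  by_contra hcon
  rw [not_or] at hcon
  refine h.not_ge (Set.ncard_le_ncard ?_ (Set.toFinite _))
  intro u (hu : Reaches G v u)
  induction hu with
  | start => exact Reaches.start
  | @two a u _ he iha =>
    refine Reaches.two iha ⟨he, ?_⟩
    have hu : u ∉ S := fun hu => hcon.1 ⟨a, iha, u, hu, he⟩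
    have ha := notMem_of_reaches_restrictTo hv iha
    simp [ha, hu]
  | @three a b u _ _ hab he iha ihb =>
    refine Reaches.three iha ihb hab ⟨he, ?_⟩
    have hu : u ∉ S := fun hu => hcon.2 ⟨a, iha, b, ihb, hab, u, hu, he⟩
    have ha := notMem_of_reaches_restrictTo hv iha
    have hb := notMem_of_reaches_restrictTo hv ihb
    simp [ha, hb, hu]

end Restriction

/-! ### The joint probability that two vertices are good -/

/-- The event that the component of `v` has more than `t` vertices. -/
def bigEvent {n : ℕ} (t : ℕ) (v : Fin n) : Set (MixedHypergraph (Fin n)) :=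
  {G | t < (component G v).ncard}

theorem goodEvent_eq_bigEvent {n : ℕ} {K : ℝ} (hK : 0 ≤ K) (v : Fin n) :
    goodEvent K v = bigEvent ⌊K * Real.log n⌋₊ v := by
  ext G
  exact (Nat.floor_lt (mul_nonneg hK (Real.log_natCast_nonneg n))).symm

theorem explored_relabel {n : ℕ} (t : ℕ) (τ : Equiv.Perm (Fin n)) (G : MixedHypergraph (Fin n))
    (v : Fin n) : (explored t G (τ v)).2 = (explored t (relabel τ G) v).2.map τ.toEmbedding := by
  unfold explored
  rw [grow_relabel]

theorem real_bigEvent_eq {n : ℕ} (p₂ p₃ : I) (t : ℕ) (v w : Fin n) :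
    (randomHypergraph n p₂ p₃).real (bigEvent t v) =
      (randomHypergraph n p₂ p₃).real (bigEvent t w) := by
  rw [← real_preimage_relabel p₂ p₃ (Equiv.swap v w) (bigEvent t v)]
  congr 1
  ext G
  have h := explored_relabel t (Equiv.swap v w) G v
  rw [Equiv.swap_apply_left] at h
  simp only [bigEvent, Set.mem_preimage, Set.mem_ofPred_eq, lt_ncard_component_iff, h,
    Finset.card_map]

/-- The exploration, the component of `w` outside the reached set and the edge `i` are read from
three disjoint sets of edges. -/
theorem real_explored_inter_le_of_edge {n : ℕ} (p₂ p₃ : I) (t : ℕ) (v w : Fin n)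
    {x : Finset (Fin n) × Finset (Fin n)} (hx : x.1 ⊆ x.2) (C : Finset (Fin n))
    {i : Finset (Fin n) ⊕ Finset (Fin n)} (h1 : i ∉ exposed x.1) (h2 : i ∉ avoiding x.2) :
    (randomHypergraph n p₂ p₃).real ({G | explored t G v = x} ∩
        {G | component (restrictTo G x.2) w = C} ∩ {G | HasEdge G i}) =
      (randomHypergraph n p₂ p₃).real {G | explored t G v = x} *
        (randomHypergraph n p₂ p₃).real {G | component (restrictTo G x.2) w = C} *
        edgeProb p₂ p₃ i := by
  have hd1 := detBy_explored t v x
  have hd2 := detBy_restrictTo x.2 fun G : MixedHypergraph (Fin n) => component G w = C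
  rw [DetBy.real_inter p₂ p₃ (hd1.inter hd2) (detBy_hasEdge i)
    (Set.disjoint_singleton_right.2 (by simp [h1, h2])), DetBy.real_inter p₂ p₃ hd1 hd2
    (disjoint_exposed_avoiding hx), real_hasEdge]

theorem edgeProb_inl_le {n : ℕ} (p₂ p₃ : I) (e : Finset (Fin n)) :
    edgeProb p₂ p₃ (Sum.inl e) ≤ p₂ := by
  simp only [edgeProb, Sum.elim_inl]
  split_ifs
  · exact le_rfl
  · exact p₂.2.1

theorem edgeProb_inr_le {n : ℕ} (p₂ p₃ : I) (e : Finset (Fin n)) :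
    edgeProb p₂ p₃ (Sum.inr e) ≤ p₃ := by
  simp only [edgeProb, Sum.elim_inr]
  split_ifs
  · exact le_rfl
  · exact p₃.2.1

/-- Given the exploration from `v`, a vertex outside of the explored set is hardly more likely than
before to have a big component. -/
theorem real_explored_inter_bigEvent_le {n : ℕ} (p₂ p₃ : I) (t b : ℕ) (v w : Fin n)
    {x : Finset (Fin n) × Finset (Fin n)} (hx : x.1 ⊆ x.2) (hb : x.2.card ≤ b) (hw : w ∉ x.2) :
    (randomHypergraph n p₂ p₃).real ({G | explored t G v = x} ∩ bigEvent t w) ≤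
      (randomHypergraph n p₂ p₃).real {G | explored t G v = x} *
        ((randomHypergraph n p₂ p₃).real (bigEvent t w) + (t * b * p₂ + t * t * b * p₃)) := by
  classical
  set μ := randomHypergraph n p₂ p₃ with hμ
  set R : Set (MixedHypergraph (Fin n)) := {G | explored t G v = x} with hR
  set Q : Finset (Fin n) → Set (MixedHypergraph (Fin n)) :=
    fun C => {G | component (restrictTo G x.2) w = C} with hQ
  set 𝒞 : Finset (Finset (Fin n)) := Finset.univ.filter fun C => C.card ≤ t ∧ Disjoint C x.2
  -- Either the component of `w` is already big without the reached set `x.2`, or it is some small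
  -- set `C` there and an edge leads from `C` into `x.2`.
  have hcover : R ∩ bigEvent t w ⊆
      (R ∩ {G | t < (component (restrictTo G x.2) w).ncard}) ∪
      ⋃ C ∈ 𝒞, ((⋃ y ∈ C ×ˢ (x.2 \ x.1), R ∩ Q C ∩ {G | HasEdge G (Sum.inl {y.1, y.2})}) ∪
        ⋃ y ∈ C.offDiag ×ˢ x.2, R ∩ Q C ∩ {G | HasEdge G (Sum.inr {y.1.1, y.1.2, y.2})}) := by
    rintro G ⟨hGR, hGw⟩
    by_cases hbig : t < (component (restrictTo G x.2) w).ncard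
    · exact Or.inl ⟨hGR, hbig⟩
    right
    push Not at hbig
    set C : Finset (Fin n) := (Set.toFinite (component (restrictTo G x.2) w)).toFinset with hC
    have hCc : (C : Set (Fin n)) = component (restrictTo G x.2) w := Set.Finite.coe_toFinset _
    have hmem : ∀ a, a ∈ C ↔ a ∈ component (restrictTo G x.2) w := by
      intro a
      rw [← hCc, Finset.mem_coe]
    have hCS : ∀ a ∈ C, a ∉ x.2 := fun a ha =>
      notMem_of_reaches_restrictTo hw ((hmem a).1 ha)
    have hC𝒞 : C ∈ 𝒞 := by
      refine Finset.mem_filter.2 ⟨Finset.mem_univ _, ?_, Finset.disjoint_left.2 hCS⟩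
      rwa [← Set.ncard_coe_finset, hCc]
    have hGQ : G ∈ Q C := hCc.symm
    refine Set.mem_biUnion hC𝒞 ?_
    rcases exists_edge_of_ncard_lt hw (hbig.trans_lt hGw) with ⟨a, ha, u, hu, he⟩ |
      ⟨a, ha, b, hb, hab, u, hu, he⟩
    · left
      have ha' := (hmem a).2 ha
      refine Set.mem_biUnion (x := (a, u)) ?_ ⟨⟨hGR, hGQ⟩, he⟩
      -- A 2-edge from `C` cannot end in the exposed set `x.1`, since all neighbours of that set are
      -- reached while `C` avoids `x.2`. So its endpoint is reached but unexposed, and the edge is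
      -- unread. A 3-edge with two vertices in `C` needs no such argument, as it has only one vertex
      -- in `x.2`.
      refine Finset.mem_coe.2 (Finset.mem_product.2 ⟨ha', Finset.mem_sdiff.2 ⟨hu, fun huJ => ?_⟩⟩)
      have hsub := nbrs_grow_fst_subset t G v (Fintype.card (Fin n))
      change nbrs G (explored t G v).1 ⊆ (explored t G v).2 at hsub
      have hGR' : explored t G v = x := hGR
      rw [hGR'] at hsub
      exact hCS a ha' (hsub (mem_nbrs.2 (Or.inl ⟨u, huJ, by rwa [Finset.pair_comm]⟩)))
    · right
      refine Set.mem_biUnion (x := ((a, b), u)) ?_ ⟨⟨hGR, hGQ⟩, he⟩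
      exact Finset.mem_coe.2 (Finset.mem_product.2
        ⟨Finset.mem_offDiag.2 ⟨(hmem a).2 ha, (hmem b).2 hb, hab⟩, hu⟩)
  have hfirst : μ.real (R ∩ {G | t < (component (restrictTo G x.2) w).ncard}) ≤
      μ.real R * μ.real (bigEvent t w) := by
    rw [hμ, DetBy.real_inter p₂ p₃ (detBy_explored t v x) (detBy_restrictTo x.2
      fun G : MixedHypergraph (Fin n) => t < (component G w).ncard) (disjoint_exposed_avoiding hx)]
    refine mul_le_mul_of_nonneg_left (measureReal_mono ?_) measureReal_nonneg
    intro G hG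
    exact hG.trans_le (Set.ncard_le_ncard (component_restrictTo_subset G x.2 w) (Set.toFinite _))
  have hp2 : (0 : ℝ) ≤ p₂ := p₂.2.1
  have hp3 : (0 : ℝ) ≤ p₃ := p₃.2.1
  have hC : ∀ C ∈ 𝒞, μ.real
      ((⋃ y ∈ C ×ˢ (x.2 \ x.1), R ∩ Q C ∩ {G | HasEdge G (Sum.inl {y.1, y.2})}) ∪
        ⋃ y ∈ C.offDiag ×ˢ x.2, R ∩ Q C ∩ {G | HasEdge G (Sum.inr {y.1.1, y.1.2, y.2})}) ≤
      μ.real (Q C) * (μ.real R * (t * b * p₂ + t * t * b * p₃)) := by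
    intro C hC
    obtain ⟨-, hCt, hCd⟩ := Finset.mem_filter.1 hC
    have hCt' : (C.card : ℝ) ≤ t := by exact_mod_cast hCt
    have hCS : ∀ a ∈ C, a ∉ x.2 := fun a ha => Finset.disjoint_left.1 hCd ha
    have h2 : μ.real (⋃ y ∈ C ×ˢ (x.2 \ x.1), R ∩ Q C ∩ {G | HasEdge G (Sum.inl {y.1, y.2})}) ≤
        t * b * (μ.real R * μ.real (Q C) * p₂) := by
      refine (measureReal_biUnion_finset_le _ _).trans ?_
      have hterm : ∀ y ∈ C ×ˢ (x.2 \ x.1),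
          μ.real (R ∩ Q C ∩ {G | HasEdge G (Sum.inl {y.1, y.2})}) ≤
            μ.real R * μ.real (Q C) * p₂ := by
        intro y hy
        obtain ⟨hy1, hy2⟩ := Finset.mem_product.1 hy
        obtain ⟨hy2, hy3⟩ := Finset.mem_sdiff.1 hy2
        rw [hμ, hR, hQ, real_explored_inter_le_of_edge p₂ p₃ t v w hx C]
        · exact mul_le_mul_of_nonneg_left (edgeProb_inl_le _ _ _) (by positivity)
        · rintro ⟨a, ha, hae⟩
          simp only [Finset.mem_insert, Finset.mem_singleton] at hae
          rcases hae with rfl | rfl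
          · exact hCS _ hy1 (hx ha)
          · exact hy3 ha
        · intro (hd : Disjoint _ _)
          exact Finset.disjoint_left.1 hd (show y.2 ∈ _ by simp) hy2
      refine (Finset.sum_le_sum hterm).trans ?_
      rw [Finset.sum_const, Finset.card_product, nsmul_eq_mul]
      refine mul_le_mul_of_nonneg_right ?_ (by positivity)
      have : ((x.2 \ x.1).card : ℝ) ≤ b := by
        exact_mod_cast (Finset.card_le_card Finset.sdiff_subset).trans hb
      push_cast
      gcongr
    have h3 : μ.real (⋃ y ∈ C.offDiag ×ˢ x.2,
        R ∩ Q C ∩ {G | HasEdge G (Sum.inr {y.1.1, y.1.2, y.2})}) ≤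
        t * t * b * (μ.real R * μ.real (Q C) * p₃) := by
      refine (measureReal_biUnion_finset_le _ _).trans ?_
      have hterm : ∀ y ∈ C.offDiag ×ˢ x.2,
          μ.real (R ∩ Q C ∩ {G | HasEdge G (Sum.inr {y.1.1, y.1.2, y.2})}) ≤
            μ.real R * μ.real (Q C) * p₃ := by
        intro y hy
        obtain ⟨hy1, hy2⟩ := Finset.mem_product.1 hy
        obtain ⟨hya, hyb, hyab⟩ := Finset.mem_offDiag.1 hy1
        rw [hμ, hR, hQ, real_explored_inter_le_of_edge p₂ p₃ t v w hx C]
        · exact mul_le_mul_of_nonneg_left (edgeProb_inr_le _ _ _) (by positivity)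
        · rintro ⟨a, ha, b, hb, hab, hae, hbe⟩
          simp only [Finset.mem_insert, Finset.mem_singleton] at hae hbe
          have ha1 : a ≠ y.1.1 := by rintro rfl; exact hCS _ hya (hx ha)
          have ha2 : a ≠ y.1.2 := by rintro rfl; exact hCS _ hyb (hx ha)
          have hb1 : b ≠ y.1.1 := by rintro rfl; exact hCS _ hya (hx hb)
          have hb2 : b ≠ y.1.2 := by rintro rfl; exact hCS _ hyb (hx hb)
          exact hab (((hae.resolve_left ha1).resolve_left ha2).trans
            ((hbe.resolve_left hb1).resolve_left hb2).symm)
        · intro (hd : Disjoint _ _)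
          exact Finset.disjoint_left.1 hd (show y.2 ∈ _ by simp) hy2
      refine (Finset.sum_le_sum hterm).trans ?_
      rw [Finset.sum_const, Finset.card_product, nsmul_eq_mul]
      refine mul_le_mul_of_nonneg_right ?_ (by positivity)
      have hod : (C.offDiag.card : ℝ) ≤ t * t := by
        have : C.offDiag.card ≤ t * t := by
          rw [Finset.offDiag_card]
          exact (Nat.sub_le _ _).trans (Nat.mul_le_mul hCt hCt)
        exact_mod_cast this
      push_cast
      gcongr
    refine (measureReal_union_le _ _).trans ((add_le_add h2 h3).trans (le_of_eq ?_))
    ring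
  -- The possible components `C` are mutually exclusive outcomes, so summing over them does not
  -- multiply the error term.
  have hsumQ : ∑ C ∈ 𝒞, μ.real (Q C) ≤ 1 := by
    rw [← measureReal_biUnion_finset _ (fun _ _ => .of_discrete)]
    · exact measureReal_le_one
    · intro C _ C' _ hne
      rw [Function.onFun, Set.disjoint_left]
      intro G hG hG'
      exact hne (Finset.coe_injective (Eq.trans (Eq.symm hG) hG'))
  refine (measureReal_mono hcover).trans ((measureReal_union_le _ _).trans ?_)
  rw [mul_add]
  refine add_le_add hfirst ((measureReal_biUnion_finset_le _ _).trans ?_)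
  refine (Finset.sum_le_sum hC).trans ?_
  rw [← Finset.sum_mul]
  exact mul_le_of_le_one_left (by positivity) hsumQ

end PropagationConnectivity

namespace PropagationConnectivity

/-! ### Averaging over the outcomes of the exploration -/

theorem measureReal_eq_sum_explored {n : ℕ} (p₂ p₃ : I) (t : ℕ) (v : Fin n)
    (X : Finset (Finset (Fin n) × Finset (Fin n))) (A : Set (MixedHypergraph (Fin n))) :
    (randomHypergraph n p₂ p₃).real ({G | explored t G v ∈ X} ∩ A) =
      ∑ x ∈ X, (randomHypergraph n p₂ p₃).real ({G | explored t G v = x} ∩ A) := by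
  rw [← measureReal_biUnion_finset _ (fun _ _ => .of_discrete)]
  · congr 1
    ext G
    simp
  · intro x _ y _ hne
    rw [Function.onFun, Set.disjoint_left]
    rintro G ⟨hG, -⟩ ⟨hG', -⟩
    exact hne (hG.symm.trans hG')

/-- Two big components, the second one starting outside of the set explored from the first. -/
theorem real_bigEvent_inter_notMem_le {n : ℕ} (p₂ p₃ : I) (t b : ℕ) (v w : Fin n) :
    (randomHypergraph n p₂ p₃).real (bigEvent t v ∩ bigEvent t w ∩
        {G | w ∉ (explored t G v).2 ∧ (explored t G v).2.card ≤ b}) ≤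
      (randomHypergraph n p₂ p₃).real (bigEvent t v) *
        ((randomHypergraph n p₂ p₃).real (bigEvent t w) + (t * b * p₂ + t * t * b * p₃)) := by
  classical
  set X : Finset (Finset (Fin n) × Finset (Fin n)) :=
    Finset.univ.filter fun x => x.1 ⊆ x.2 ∧ t < x.2.card ∧ x.2.card ≤ b ∧ w ∉ x.2 with hX
  have h1 : bigEvent t v ∩ bigEvent t w ∩
      {G | w ∉ (explored t G v).2 ∧ (explored t G v).2.card ≤ b} ⊆
      {G | explored t G v ∈ X} ∩ bigEvent t w := by
    rintro G ⟨⟨hv, hw⟩, hwS, hb⟩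
    refine ⟨?_, hw⟩
    simp only [hX, Set.mem_ofPred_eq, Finset.mem_filter, Finset.mem_univ, true_and]
    exact ⟨grow_fst_subset_snd t G v _, (lt_ncard_component_iff t G v).1 hv, hb, hwS⟩
  have h2 : (randomHypergraph n p₂ p₃).real {G | explored t G v ∈ X} ≤
      (randomHypergraph n p₂ p₃).real (bigEvent t v) := by
    refine measureReal_mono fun G hG => ?_
    simp only [hX, Set.mem_ofPred_eq, Finset.mem_filter, Finset.mem_univ, true_and] at hG
    exact (lt_ncard_component_iff t G v).2 hG.2.1
  have hp2 : (0 : ℝ) ≤ p₂ := p₂.2.1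
  have hp3 : (0 : ℝ) ≤ p₃ := p₃.2.1
  refine (measureReal_mono h1).trans ?_
  refine le_trans ?_ (mul_le_mul_of_nonneg_right h2 (by positivity))
  have h3 := measureReal_eq_sum_explored p₂ p₃ t v X Set.univ
  simp only [Set.inter_univ] at h3
  rw [measureReal_eq_sum_explored, h3, Finset.sum_mul]
  refine Finset.sum_le_sum fun x hx => ?_
  obtain ⟨-, h1, -, h3, h4⟩ := Finset.mem_filter.1 hx
  exact real_explored_inter_bigEvent_le p₂ p₃ t b v w h1 h3 h4

/-- By symmetry, the explored set is unlikely to contain a given vertex. -/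
theorem real_bigEvent_inter_mem_le {n : ℕ} (p₂ p₃ : I) (t b : ℕ) {v w : Fin n} (hvw : v ≠ w) :
    (n - 1 : ℝ) * (randomHypergraph n p₂ p₃).real (bigEvent t v ∩
        {G | w ∈ (explored t G v).2 ∧ (explored t G v).2.card ≤ b}) ≤
      b * (randomHypergraph n p₂ p₃).real (bigEvent t v) := by
  classical
  set μ := randomHypergraph n p₂ p₃ with hμ
  set f : Fin n → ℝ := fun u => μ.real (bigEvent t v ∩
        {G | u ∈ (explored t G v).2 ∧ (explored t G v).2.card ≤ b}) with hf
  -- The transposition of `u` and `w` fixes `v`, so it carries the exploration from `v` to itself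
  -- and exchanges the two memberships.
  have hsymm : ∀ u, u ≠ v → f u = f w := by
    intro u hu
    simp only [hf]
    rw [hμ, ← real_preimage_relabel p₂ p₃ (Equiv.swap u w)]
    congr 1
    ext G
    have h := explored_relabel t (Equiv.swap u w) G v
    rw [Equiv.swap_apply_of_ne_of_ne hu.symm hvw] at h
    simp only [bigEvent, Set.mem_preimage, Set.mem_inter_iff, Set.mem_ofPred_eq,
      lt_ncard_component_iff, h, Finset.card_map, Finset.mem_map_equiv, Equiv.symm_swap,
      Equiv.swap_apply_right]
  have hsum1 : (n - 1 : ℝ) * f w ≤ ∑ u, f u := by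
    have h1 : ∑ u ∈ Finset.univ.erase v, f u = (n - 1 : ℝ) * f w := by
      rw [Finset.sum_congr rfl fun u hu => hsymm u (Finset.ne_of_mem_erase hu), Finset.sum_const,
        Finset.card_erase_of_mem (Finset.mem_univ v), Finset.card_univ, Fintype.card_fin,
        nsmul_eq_mul, Nat.cast_sub (by have := v.pos; omega), Nat.cast_one]
    rw [← h1]
    exact Finset.sum_le_sum_of_subset_of_nonneg (Finset.erase_subset _ _)
      fun _ _ _ => measureReal_nonneg
  refine hsum1.trans ?_
  set X : Finset (Finset (Fin n) × Finset (Fin n)) :=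
    Finset.univ.filter fun x => t < x.2.card ∧ x.2.card ≤ b with hX
  have hfu : ∀ u, f u = ∑ x ∈ X, if u ∈ x.2 then μ.real {G | explored t G v = x} else 0 := by
    intro u
    have hset : bigEvent t v ∩ {G | u ∈ (explored t G v).2 ∧ (explored t G v).2.card ≤ b} =
        {G | explored t G v ∈ X} ∩ {G | u ∈ (explored t G v).2} := by
      ext G
      simp only [hX, bigEvent, Set.mem_inter_iff, Set.mem_ofPred_eq, Finset.mem_filter,
        Finset.mem_univ, true_and, lt_ncard_component_iff]
      tauto
    simp only [hf]
    rw [hset, measureReal_eq_sum_explored]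
    refine Finset.sum_congr rfl fun x _ => ?_
    split_ifs with hux
    · congr 1
      ext G
      simp only [Set.mem_inter_iff, Set.mem_ofPred_eq, and_iff_left_iff_imp]
      rintro rfl
      exact hux
    · rw [Set.eq_empty_of_forall_notMem (s := {G | explored t G v = x} ∩ _), measureReal_empty]
      rintro G ⟨h1, h2⟩
      have h1' : explored t G v = x := h1
      rw [Set.mem_ofPred_eq, h1'] at h2
      exact hux h2
  -- Double counting: an outcome `x` is counted once for each vertex of `x.2`, hence at most `b`
  -- times.
  rw [Finset.sum_congr rfl fun u _ => hfu u, Finset.sum_comm]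
  have hX2 := measureReal_eq_sum_explored p₂ p₃ t v X Set.univ
  simp only [Set.inter_univ] at hX2
  have hle : μ.real {G | explored t G v ∈ X} ≤ μ.real (bigEvent t v) := by
    refine measureReal_mono fun G hG => ?_
    simp only [hX, Set.mem_ofPred_eq, Finset.mem_filter, Finset.mem_univ, true_and] at hG
    exact (lt_ncard_component_iff t G v).2 hG.1
  refine le_trans ?_ (mul_le_mul_of_nonneg_left hle (Nat.cast_nonneg b))
  rw [hμ, hX2, Finset.mul_sum]
  refine Finset.sum_le_sum fun x hx => ?_
  rw [Finset.sum_ite_mem, Finset.univ_inter, Finset.sum_const, nsmul_eq_mul]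
  refine mul_le_mul_of_nonneg_right ?_ measureReal_nonneg
  exact_mod_cast (Finset.mem_filter.1 hx).2.2

/-! ### Degrees -/

open Classical in
/-- The number of edges present in a small-probability family exceeds `d` with probability at most
`1 / d!`. -/
theorem real_le_card_filter_hasEdge_le {n : ℕ} (p₂ p₃ : I) (U : Finset (Fin n))
    (e : Fin n → Finset (Fin n) ⊕ Finset (Fin n)) (he : Set.InjOn e U) {p : ℝ}
    (hp : ∀ u ∈ U, edgeProb p₂ p₃ (e u) ≤ p) (hp0 : 0 ≤ p) (hnp : n * p ≤ 1) (d : ℕ) :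
    (randomHypergraph n p₂ p₃).real {G | d ≤ (U.filter fun u => HasEdge G (e u)).card} ≤
      1 / d.factorial := by
  have hsub : {G : MixedHypergraph (Fin n) | d ≤ (U.filter fun u => HasEdge G (e u)).card} ⊆
      ⋃ D ∈ U.powersetCard d, {G | ∀ i ∈ D.image e, HasEdge G i} := by
    intro G hG
    obtain ⟨D, hD, hDd⟩ := Finset.exists_subset_card_eq hG
    refine Set.mem_biUnion (x := D) (Finset.mem_coe.2 (Finset.mem_powersetCard.2
      ⟨hD.trans (Finset.filter_subset _ _), hDd⟩)) ?_
    intro i hi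
    obtain ⟨u, hu, rfl⟩ := Finset.mem_image.1 hi
    exact (Finset.mem_filter.1 (hD hu)).2
  refine (measureReal_mono hsub (measure_ne_top _ _)).trans ((measureReal_biUnion_finset_le _ _).trans ?_)
  have hterm : ∀ D ∈ U.powersetCard d,
      (randomHypergraph n p₂ p₃).real {G | ∀ i ∈ D.image e, HasEdge G i} ≤ p ^ d := by
    intro D hD
    obtain ⟨hDU, hDd⟩ := Finset.mem_powersetCard.1 hD
    rw [real_forall_hasEdge, Finset.prod_image (he.mono (by exact_mod_cast hDU)), ← hDd,
      ← Finset.prod_const]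
    exact Finset.prod_le_prod (fun _ _ => edgeProb_nonneg _ _ _) fun u hu => hp u (hDU hu)
  refine (Finset.sum_le_sum hterm).trans ?_
  rw [Finset.sum_const, Finset.card_powersetCard, nsmul_eq_mul]
  have hU : U.card ≤ n := (Finset.card_le_univ U).trans_eq (Fintype.card_fin n)
  have h1 : (U.card.choose d : ℝ) ≤ (n : ℝ) ^ d / d.factorial :=
    (Nat.choose_le_pow_div d U.card).trans (by gcongr)
  -- The union bound over `d`-subsets is at most (np)^d / d!, and np ≤ 1.
  calc (U.card.choose d : ℝ) * p ^ d ≤ (n : ℝ) ^ d / d.factorial * p ^ d := by gcongr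
    _ = (n * p) ^ d / d.factorial := by rw [mul_pow]; ring
    _ ≤ 1 / d.factorial := by
      gcongr
      exact pow_le_one₀ (by positivity) hnp

open Classical in
/-- The vertices joined to `a` by a 2-edge. -/
noncomputable def nbrs₂ {n : ℕ} (G : MixedHypergraph (Fin n)) (a : Fin n) : Finset (Fin n) :=
  (Finset.univ.erase a).filter fun u => HasEdge G (Sum.inl {a, u})

open Classical in
/-- The vertices that form a 3-edge with `y.1` and `y.2`. -/
noncomputable def nbrs₃ {n : ℕ} (G : MixedHypergraph (Fin n)) (y : Fin n × Fin n) :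
    Finset (Fin n) :=
  ((Finset.univ.erase y.1).erase y.2).filter fun u => HasEdge G (Sum.inr {y.1, y.2, u})

/-- A union bound over n vertices and n² ordered pairs. With d = ⌈5 ln n⌉ the factorial outweighs
this polynomial even after division by P². -/
theorem real_exists_large_degree_le {n : ℕ} (p₂ p₃ : I) (h₂ : n * (p₂ : ℝ) ≤ 1)
    (h₃ : n * (p₃ : ℝ) ≤ 1) (d : ℕ) :
    (randomHypergraph n p₂ p₃).real
        {G | (∃ a, d ≤ (nbrs₂ G a).card) ∨ ∃ y, d ≤ (nbrs₃ G y).card} ≤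
      (n + n * n) / d.factorial := by
  have hsub : {G : MixedHypergraph (Fin n) | (∃ a, d ≤ (nbrs₂ G a).card) ∨
      ∃ y, d ≤ (nbrs₃ G y).card} =
      (⋃ a ∈ (Finset.univ : Finset (Fin n)), {G | d ≤ (nbrs₂ G a).card}) ∪
      ⋃ y ∈ (Finset.univ : Finset (Fin n × Fin n)), {G | d ≤ (nbrs₃ G y).card} := by
    ext G
    simp
  rw [hsub]
  refine (measureReal_union_le _ _).trans ?_
  rw [add_div]
  refine add_le_add ?_ ?_
  · refine (measureReal_biUnion_finset_le _ _).trans ?_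
    refine (Finset.sum_le_sum (g := fun _ => 1 / (d.factorial : ℝ)) fun a _ => ?_).trans ?_
    · refine real_le_card_filter_hasEdge_le p₂ p₃ _ (fun u => Sum.inl {a, u}) ?_
        (fun u _ => edgeProb_inl_le p₂ p₃ _) p₂.2.1 h₂ d
      intro u hu u' hu' h
      have h' : u ∈ ({a, u'} : Finset (Fin n)) := by rw [← Sum.inl.inj h]; simp
      simp only [Finset.mem_insert, Finset.mem_singleton] at h'
      exact h'.resolve_left (by simpa using hu)
    · simp [div_eq_mul_inv]
  · refine (measureReal_biUnion_finset_le _ _).trans ?_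
    refine (Finset.sum_le_sum (g := fun _ => 1 / (d.factorial : ℝ)) fun y _ => ?_).trans ?_
    · refine real_le_card_filter_hasEdge_le p₂ p₃ _ (fun u => Sum.inr {y.1, y.2, u}) ?_
        (fun u _ => edgeProb_inr_le p₂ p₃ _) p₃.2.1 h₃ d
      intro u hu u' hu' h
      have h' : u ∈ ({y.1, y.2, u'} : Finset (Fin n)) := by rw [← Sum.inr.inj h]; simp
      simp only [Finset.mem_insert, Finset.mem_singleton] at h'
      simp only [Finset.coe_erase, Finset.coe_univ, Set.mem_sdiff, Set.mem_univ, true_and,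
        Set.mem_singleton_iff] at hu
      tauto
    · simp [div_eq_mul_inv]

theorem card_explored_le {n : ℕ} (t d : ℕ) (G : MixedHypergraph (Fin n)) (v : Fin n)
    (h₂ : ∀ a, (nbrs₂ G a).card ≤ d) (h₃ : ∀ y, (nbrs₃ G y).card ≤ d) :
    (explored t G v).2.card ≤ 1 + t + t * d + t * t * d := by
  classical
  set J := (explored t G v).1 with hJ
  have hJt : J.card ≤ t := card_grow_fst_le t G v _
  have hsub : (explored t G v).2 ⊆
      {v} ∪ J ∪ J.biUnion (nbrs₂ G) ∪ (J ×ˢ J).biUnion (nbrs₃ G) := by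
    intro u hu
    have h := grow_snd_subset t G v _ hu
    change u ∈ {v} ∪ J ∪ nbrs G J at h
    by_cases huJ : u ∈ {v} ∪ J
    · exact Finset.mem_union_left _ (Finset.mem_union_left _ huJ)
    have hne : ∀ a ∈ J, u ≠ a := by
      rintro a ha rfl
      exact huJ (Finset.mem_union_right _ ha)
    rcases Finset.mem_union.1 h with h | h
    · exact absurd h huJ
    rcases mem_nbrs.1 h with ⟨a, ha, he⟩ | ⟨a, ha, b, hb, -, he⟩
    · refine Finset.mem_union_left _ (Finset.mem_union_right _ (Finset.mem_biUnion.2 ⟨a, ha, ?_⟩))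
      simp only [nbrs₂, Finset.mem_filter, Finset.mem_erase, Finset.mem_univ, and_true]
      exact ⟨hne a ha, he⟩
    · refine Finset.mem_union_right _ (Finset.mem_biUnion.2
        ⟨(a, b), Finset.mem_product.2 ⟨ha, hb⟩, ?_⟩)
      simp only [nbrs₃, Finset.mem_filter, Finset.mem_erase, Finset.mem_univ, and_true]
      exact ⟨⟨hne b hb, hne a ha⟩, he⟩
  refine (Finset.card_le_card hsub).trans ?_
  refine (Finset.card_union_le _ _).trans (add_le_add ((Finset.card_union_le _ _).trans
    (add_le_add ((Finset.card_union_le _ _).trans (add_le_add (by simp) hJt)) ?_)) ?_)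
  · exact (Finset.card_biUnion_le_card_mul _ _ _ fun a _ => h₂ a).trans
      (Nat.mul_le_mul_right d hJt)
  · refine (Finset.card_biUnion_le_card_mul _ _ _ fun a _ => h₃ a).trans
      (Nat.mul_le_mul_right d ?_)
    rw [Finset.card_product]
    exact Nat.mul_le_mul hJt hJt

/-- The joint probability that two vertices have big components. -/
theorem real_bigEvent_inter_le {n : ℕ} (p₂ p₃ : I) (h₂ : n * (p₂ : ℝ) ≤ 1)
    (h₃ : n * (p₃ : ℝ) ≤ 1) (t d b : ℕ) (hb : b = 1 + t + t * d + t * t * d)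
    {v w : Fin n} (hvw : v ≠ w) :
    (randomHypergraph n p₂ p₃).real (bigEvent t v ∩ bigEvent t w) ≤
      (randomHypergraph n p₂ p₃).real (bigEvent t v) *
        ((randomHypergraph n p₂ p₃).real (bigEvent t w) +
          (t * b * p₂ + t * t * b * p₃ + b / (n - 1))) + (n + n * n) / d.factorial := by
  have hn : (0 : ℝ) < n - 1 := by
    have : 1 < n := by
      by_contra hcon
      exact hvw (Fin.ext (by omega))
    have : (1 : ℝ) < n := by exact_mod_cast this
    linarith
  have hcover : bigEvent t v ∩ bigEvent t w ⊆
      (bigEvent t v ∩ bigEvent t w ∩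
        {G | w ∉ (explored t G v).2 ∧ (explored t G v).2.card ≤ b}) ∪
      (bigEvent t v ∩ {G | w ∈ (explored t G v).2 ∧ (explored t G v).2.card ≤ b}) ∪
      {G | (∃ a, d ≤ (nbrs₂ G a).card) ∨ ∃ y, d ≤ (nbrs₃ G y).card} := by
    rintro G ⟨hv, hw⟩
    by_cases hdeg : (∃ a, d ≤ (nbrs₂ G a).card) ∨ ∃ y, d ≤ (nbrs₃ G y).card
    · exact Or.inr hdeg
    left
    push Not at hdeg
    have hS : (explored t G v).2.card ≤ b :=
      hb ▸ card_explored_le t d G v (fun a => (hdeg.1 a).le) (fun y => (hdeg.2 y).le)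
    by_cases hwS : w ∈ (explored t G v).2
    · exact Or.inr ⟨hv, hwS, hS⟩
    · exact Or.inl ⟨⟨hv, hw⟩, hwS, hS⟩
  refine (measureReal_mono hcover).trans ((measureReal_union_le _ _).trans
    (add_le_add ((measureReal_union_le _ _).trans
      (add_le_add (real_bigEvent_inter_notMem_le p₂ p₃ t b v w)
        ((le_div_iff₀' hn).2 (real_bigEvent_inter_mem_le p₂ p₃ t b hvw))) |>.trans (le_of_eq ?_))
      (real_exists_large_degree_le p₂ p₃ h₂ h₃ d)))
  ring

end PropagationConnectivity

namespace PropagationConnectivity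

/-! ### The second moment method -/

/-- Chebyshev's inequality for the number X of events that occur, with mean m = nP: the hypotheses
give E(X - m)² ≤ m + δm², while (X - m)² = m² where no event occurs. -/
theorem real_iInter_compl_le {Ω : Type*} [MeasurableSpace Ω] [DiscreteMeasurableSpace Ω] [Finite Ω]
    (μ : Measure Ω) [IsProbabilityMeasure μ] {n : ℕ} (A : Fin n → Set Ω) {P δ : ℝ} (hn : 0 < n)
    (hP : 0 < P) (hδ : 0 ≤ δ) (h₁ : ∀ v, μ.real (A v) = P)
    (h₂ : ∀ v w, v ≠ w → μ.real (A v ∩ A w) ≤ P * P * (1 + δ)) :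
    μ.real (⋂ v, (A v)ᶜ) ≤ 1 / (n * P) + δ := by
  classical
  have hn' : (0 : ℝ) < n := by exact_mod_cast hn
  set X : Ω → ℝ := fun ω => ∑ v, (A v).indicator 1 ω with hX
  set m : ℝ := n * P with hm
  have hm0 : 0 < m := by positivity
  have hX1 : ∫ ω, X ω ∂μ = m := by
    rw [hX, integral_finsetSum _ fun _ _ => Integrable.of_finite]
    simp only [integral_indicator_one MeasurableSet.of_discrete, h₁]
    simp [hm]
  have hX2 : ∫ ω, X ω * X ω ∂μ ≤ m + m * m * (1 + δ) := by
    have hXX : ∀ ω, X ω * X ω = ∑ v, ∑ w, (A v ∩ A w).indicator (1 : Ω → ℝ) ω := by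
      intro ω
      simp only [hX, Finset.sum_mul_sum, Set.inter_indicator_one, Pi.mul_apply]
    simp only [hXX]
    rw [integral_finsetSum _ fun _ _ => Integrable.of_finite]
    have hv : ∀ v ∈ Finset.univ, ∫ ω, ∑ w, (A v ∩ A w).indicator (1 : Ω → ℝ) ω ∂μ ≤
        P + n * (P * P * (1 + δ)) := by
      intro v _
      rw [integral_finsetSum _ fun _ _ => Integrable.of_finite]
      simp only [integral_indicator_one MeasurableSet.of_discrete]
      rw [← Finset.add_sum_erase _ _ (Finset.mem_univ v), Set.inter_self, h₁]
      refine add_le_add le_rfl ((Finset.sum_le_sum fun w hw =>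
        h₂ v w (Finset.ne_of_mem_erase hw).symm).trans ?_)
      rw [Finset.sum_const, nsmul_eq_mul]
      refine mul_le_mul_of_nonneg_right ?_ (by positivity)
      exact_mod_cast (Finset.card_le_univ _).trans_eq (Fintype.card_fin n)
    refine (Finset.sum_le_sum hv).trans (le_of_eq ?_)
    rw [Finset.sum_const, Finset.card_univ, Fintype.card_fin, nsmul_eq_mul, hm]
    ring
  have hvar : ∫ ω, (X ω - m) ^ 2 ∂μ ≤ m + m * m * δ := by
    have : ∀ ω, (X ω - m) ^ 2 = X ω * X ω - 2 * m * X ω + m * m := fun ω => by ring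
    simp only [this]
    rw [integral_add Integrable.of_finite Integrable.of_finite,
      integral_sub Integrable.of_finite Integrable.of_finite, integral_const_mul, hX1,
      integral_const, probReal_univ, one_smul]
    linarith
  have hlow : m * m * μ.real (⋂ v, (A v)ᶜ) ≤ ∫ ω, (X ω - m) ^ 2 ∂μ := by
    have : m * m * μ.real (⋂ v, (A v)ᶜ) =
        ∫ ω, m * m * (⋂ v, (A v)ᶜ).indicator (1 : Ω → ℝ) ω ∂μ := by
      rw [integral_const_mul, integral_indicator_one MeasurableSet.of_discrete]
    rw [this]
    refine integral_mono Integrable.of_finite Integrable.of_finite fun ω => ?_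
    by_cases hω : ω ∈ ⋂ v, (A v)ᶜ
    · have hX0 : X ω = 0 := by
        refine Finset.sum_eq_zero fun v _ => Set.indicator_of_notMem ?_ _
        exact Set.mem_iInter.1 hω v
      simp only [Set.indicator_of_mem hω, hX0, Pi.one_apply]
      linarith
    · simp only [Set.indicator_of_notMem hω]
      rw [mul_zero]
      positivity
  have h := hlow.trans hvar
  have : μ.real (⋂ v, (A v)ᶜ) ≤ (m + m * m * δ) / (m * m) := by
    rw [le_div_iff₀ (by positivity)]
    linarith
  refine this.trans (le_of_eq ?_)
  field_simp

/-! ### Negligible error terms -/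

theorem isBigO_ceil_mul_log (C : ℝ) {s : ℝ} (hs : 0 < s) :
    (fun n : ℕ => (⌈C * Real.log n⌉₊ : ℝ)) =O[atTop] fun n : ℕ => (n : ℝ) ^ s := by
  have h1 : (fun n : ℕ => Real.log n) =O[atTop] fun n : ℕ => (n : ℝ) ^ s :=
    (isLittleO_log_rpow_atTop hs).isBigO.comp_tendsto tendsto_natCast_atTop_atTop
  have h2 : (fun n : ℕ => (⌈C * Real.log n⌉₊ : ℝ)) =O[atTop] fun n : ℕ => Real.log n := by
    refine Asymptotics.IsBigO.of_bound (|C| + 1) ?_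
    filter_upwards [tendsto_log_natCast.eventually_ge_atTop 1] with n hn
    rw [Real.norm_of_nonneg (Nat.cast_nonneg _), Real.norm_of_nonneg (by linarith)]
    have h3 : ⌈C * Real.log n⌉₊ ≤ ⌈|C| * Real.log n⌉₊ :=
      Nat.ceil_mono (mul_le_mul_of_nonneg_right (le_abs_self C) (by linarith))
    have h4 := (Nat.ceil_lt_add_one (show 0 ≤ |C| * Real.log n by positivity)).le
    have h5 : (⌈C * Real.log n⌉₊ : ℝ) ≤ ⌈|C| * Real.log n⌉₊ := by exact_mod_cast h3
    linarith
  exact h2.trans h1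

theorem isBigO_floor_mul_log (C : ℝ) {s : ℝ} (hs : 0 < s) :
    (fun n : ℕ => (⌊C * Real.log n⌋₊ : ℝ)) =O[atTop] fun n : ℕ => (n : ℝ) ^ s := by
  refine (Asymptotics.IsBigO.of_bound 1 (Eventually.of_forall fun n => ?_)).trans
    (isBigO_ceil_mul_log C hs)
  rw [one_mul, Real.norm_of_nonneg (Nat.cast_nonneg _), Real.norm_of_nonneg (Nat.cast_nonneg _)]
  exact_mod_cast Nat.floor_le_ceil _

theorem isBigO_mul_rpow {f g : ℕ → ℝ} {a b : ℝ}
    (hf : f =O[atTop] fun n : ℕ => (n : ℝ) ^ a) (hg : g =O[atTop] fun n : ℕ => (n : ℝ) ^ b) :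
    (fun n => f n * g n) =O[atTop] fun n : ℕ => (n : ℝ) ^ (a + b) := by
  refine (hf.mul hg).congr' (EventuallyEq.refl _ _) ?_
  filter_upwards [eventually_gt_atTop 0] with n hn
  rw [Real.rpow_add (by exact_mod_cast hn)]

theorem isBigO_rpow_mono {f : ℕ → ℝ} {a b : ℝ} (hab : a ≤ b)
    (hf : f =O[atTop] fun n : ℕ => (n : ℝ) ^ a) : f =O[atTop] fun n : ℕ => (n : ℝ) ^ b := by
  refine hf.trans (Asymptotics.IsBigO.of_bound 1 ?_)
  filter_upwards [eventually_ge_atTop 1] with n hn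
  rw [one_mul, Real.norm_of_nonneg (by positivity), Real.norm_of_nonneg (by positivity)]
  exact Real.rpow_le_rpow_of_exponent_le (by exact_mod_cast hn) hab

theorem isBigO_one_rpow {s : ℝ} (hs : 0 ≤ s) :
    (fun _ : ℕ => (1 : ℝ)) =O[atTop] fun n : ℕ => (n : ℝ) ^ s :=
  isBigO_rpow_mono hs (by simpa using Asymptotics.isBigO_refl (fun _ : ℕ => (1 : ℝ)) atTop)

/-- The size bound for the explored set. -/
noncomputable def sizeBound (K : ℝ) (n : ℕ) : ℕ :=
  1 + ⌊K * Real.log n⌋₊ + ⌊K * Real.log n⌋₊ * ⌈5 * Real.log n⌉₊ +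
    ⌊K * Real.log n⌋₊ * ⌊K * Real.log n⌋₊ * ⌈5 * Real.log n⌉₊

/-- The relative error in the bound for the joint probability. -/
noncomputable def relError (K c : ℝ) (p₂ p₃ : ℕ → ℝ) (n : ℕ) : ℝ :=
  (n : ℝ) ^ (1 - c) * (⌊K * Real.log n⌋₊ * sizeBound K n * p₂ n +
    ⌊K * Real.log n⌋₊ * ⌊K * Real.log n⌋₊ * sizeBound K n * p₃ n + sizeBound K n / (n - 1)) +
  (n : ℝ) ^ (2 - 2 * c) * ((n + n * n) / (⌈5 * Real.log n⌉₊).factorial)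

/-- Every logarithmic factor is absorbed into n^(c/10). The bracket contains at most five of them
besides 1/n, so the first summand is O(n^(-c/2)). -/
theorem tendsto_relError (K : ℝ) {c : ℝ} (hc : 0 < c) {p₂ p₃ : ℕ → ℝ}
    (hp₂ : p₂ =O[atTop] fun n : ℕ => (n : ℝ) ^ (-1 : ℝ))
    (hp₃ : p₃ =O[atTop] fun n : ℕ => (n : ℝ) ^ (-1 : ℝ)) :
    Tendsto (relError K c p₂ p₃) atTop (𝓝 0) := by
  have hs : 0 < c / 10 := by positivity
  have ht := isBigO_floor_mul_log K hs
  have hd := isBigO_ceil_mul_log 5 hs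
  have hone := isBigO_one_rpow hs.le
  have hb : (fun n => (sizeBound K n : ℝ)) =O[atTop] fun n : ℕ => (n : ℝ) ^ (3 * (c / 10)) := by
    have h1 := isBigO_rpow_mono (show c / 10 ≤ 3 * (c / 10) by linarith) hone
    have h2 := isBigO_rpow_mono (show c / 10 ≤ 3 * (c / 10) by linarith) ht
    have h3 := isBigO_rpow_mono (show c / 10 + c / 10 ≤ 3 * (c / 10) by linarith)
      (isBigO_mul_rpow ht hd)
    have h4 := isBigO_rpow_mono (show c / 10 + c / 10 + c / 10 ≤ 3 * (c / 10) by linarith)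
      (isBigO_mul_rpow (isBigO_mul_rpow ht ht) hd)
    refine (((h1.add h2).add h3).add h4).congr_left fun n => ?_
    simp [sizeBound]
  have hinv : (fun n : ℕ => ((n : ℝ) - 1)⁻¹) =O[atTop] fun n : ℕ => (n : ℝ) ^ (-1 : ℝ) := by
    refine Asymptotics.IsBigO.of_bound 2 ?_
    filter_upwards [eventually_ge_atTop 2] with n hn
    have hn' : (2 : ℝ) ≤ n := by exact_mod_cast hn
    rw [Real.rpow_neg_one, Real.norm_of_nonneg (inv_nonneg.2 (by linarith)),
      Real.norm_of_nonneg (by positivity), ← div_eq_mul_inv, inv_le_comm₀ (by linarith)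
        (by positivity), inv_div]
    linarith
  have hA : (fun n : ℕ => (n : ℝ) ^ (1 - c) * (⌊K * Real.log n⌋₊ * sizeBound K n * p₂ n +
      ⌊K * Real.log n⌋₊ * ⌊K * Real.log n⌋₊ * sizeBound K n * p₃ n +
      sizeBound K n / (n - 1))) =O[atTop] fun n : ℕ => (n : ℝ) ^ (1 - c + (c / 2 - 1)) := by
    refine isBigO_mul_rpow (Asymptotics.isBigO_refl _ _) (((isBigO_rpow_mono ?_
      (isBigO_mul_rpow (isBigO_mul_rpow ht hb) hp₂)).add (isBigO_rpow_mono ?_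
      (isBigO_mul_rpow (isBigO_mul_rpow (isBigO_mul_rpow ht ht) hb) hp₃))).add
      (isBigO_rpow_mono ?_ (isBigO_mul_rpow hb hinv)))
    all_goals linarith
  have hA1 : Tendsto (fun n : ℕ => (n : ℝ) ^ (1 - c + (c / 2 - 1))) atTop (𝓝 0) := by
    refine ((tendsto_rpow_neg_atTop (show 0 < c / 2 by positivity)).comp
      (tendsto_natCast_atTop_atTop (R := ℝ))).congr fun n => ?_
    simp only [Function.comp]
    congr 1
    ring
  have hA0 := hA.trans_tendsto hA1
  have hB0 : Tendsto (fun n : ℕ => (n : ℝ) ^ (2 - 2 * c) *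
      ((n + n * n) / (⌈5 * Real.log n⌉₊).factorial)) atTop (𝓝 0) := by
    have hlim : Tendsto (fun n : ℕ => 2 * Real.exp (Real.exp 1) / (n : ℝ)) atTop (𝓝 0) :=
      tendsto_const_div_atTop_nhds_zero_nat _
    refine squeeze_zero' (Eventually.of_forall fun n => by positivity) ?_ hlim
    filter_upwards [eventually_ge_atTop 1] with n hn
    have hn' : (1 : ℝ) ≤ n := by exact_mod_cast hn
    have hn0 : (0 : ℝ) < n := by linarith
    set d := ⌈5 * Real.log n⌉₊ with hd
    -- Together with e^d / d! ≤ e^e this gives 1/d! ≤ e^e / n^5. The remaining factors are at most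
    -- 2n^4, whence the constant 5 in `d`.
    have h1 : (n : ℝ) ^ 5 ≤ Real.exp 1 ^ d := by
      rw [← Real.exp_nat_mul, mul_one, ← Real.exp_log (pow_pos hn0 5), Real.exp_le_exp,
        Real.log_pow]
      exact_mod_cast Nat.le_ceil (5 * Real.log n)
    have h2 := Real.pow_div_factorial_le_exp (Real.exp 1) (Real.exp_pos 1).le d
    have hfac : (0 : ℝ) < d.factorial := by exact_mod_cast d.factorial_pos
    have h3 : (n : ℝ) ^ 5 / d.factorial ≤ Real.exp (Real.exp 1) :=
      (div_le_div_of_nonneg_right h1 hfac.le).trans h2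
    have h4 : (n : ℝ) ^ (2 - 2 * c) ≤ (n : ℝ) ^ 2 := by
      rw [← Real.rpow_natCast]
      exact Real.rpow_le_rpow_of_exponent_le hn' (by push_cast; linarith)
    have h5 : (n + n * n : ℝ) ≤ 2 * n ^ 2 := by nlinarith
    calc (n : ℝ) ^ (2 - 2 * c) * ((n + n * n) / d.factorial)
        ≤ (n : ℝ) ^ 2 * (2 * n ^ 2 / d.factorial) := by gcongr
      _ = 2 * ((n : ℝ) ^ 5 / d.factorial) / n := by field_simp
      _ ≤ 2 * Real.exp (Real.exp 1) / n := by gcongr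
  have := hA0.add hB0
  rw [add_zero] at this
  exact this

/-! ### The main estimate for pairs -/

/-- As 1 ≤ P x^(1-c), an absolute error `A` costs at most the relative error x^(1-c) A against P,
and `B` at most x^(2-2c) B against P². -/
theorem joint_le_of_rpow_le {P Q A B δ x c : ℝ} (hx : 0 < x) (hP : x ^ (-1 + c) ≤ P) (hA : 0 ≤ A)
    (hB : 0 ≤ B) (hQ : Q ≤ P * (P + A) + B) (hδ : δ = x ^ (1 - c) * A + x ^ (2 - 2 * c) * B) :
    Q ≤ P * P * (1 + δ) := by
  have hy : 0 < x ^ (-1 + c) := Real.rpow_pos_of_pos hx _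
  have hP0 : 0 < P := hy.trans_le hP
  have h1 : 1 ≤ P * x ^ (1 - c) := by
    have : x ^ (-1 + c) * x ^ (1 - c) = 1 := by
      rw [← Real.rpow_add hx]
      norm_num
    exact this.symm.trans_le
      (mul_le_mul_of_nonneg_right hP (Real.rpow_pos_of_pos hx (1 - c)).le)
  have h2 : x ^ (2 - 2 * c) = x ^ (1 - c) * x ^ (1 - c) := by
    rw [← Real.rpow_add hx]
    congr 1
    ring
  have h3 : A ≤ P * x ^ (1 - c) * A := le_mul_of_one_le_left hA h1
  have h4 : B ≤ (P * x ^ (1 - c)) * (P * x ^ (1 - c)) * B :=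
    le_mul_of_one_le_left hB (one_le_mul_of_one_le_of_one_le h1 h1)
  rw [hδ, h2]
  nlinarith [mul_le_mul_of_nonneg_left h3 hP0.le]

/-- Collects what both conclusions need: a polynomial lower bound for P, its independence of the
vertex, and near independence of pairs. Any constant K > 0 is allowed. -/
theorem eventually_pairs {ε r K : ℝ} (hε₀ : 0 < ε) (hε₁ : ε < 1) (hr : 0 < r)
    (hK : 0 < K) (hI : -1 < rateI ε r) (p₂ p₃ : ℕ → I)
    (hp₂ : ∀ᶠ n : ℕ in atTop, (p₂ n : ℝ) = (1 - ε) / n)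
    (hp₃ : ∀ᶠ n : ℕ in atTop, (p₃ n : ℝ) = r / (n * Real.log n)) :
    ∃ c : ℝ, 0 < c ∧ ∃ δ : ℕ → ℝ, Tendsto δ atTop (𝓝 0) ∧ ∀ᶠ n : ℕ in atTop, 0 ≤ δ n ∧
      (∀ v : Fin n,
        (n : ℝ) ^ (-1 + c) ≤ (randomHypergraph n (p₂ n) (p₃ n)).real (goodEvent K v)) ∧
      (∀ v w : Fin n, (randomHypergraph n (p₂ n) (p₃ n)).real (goodEvent K v) =
        (randomHypergraph n (p₂ n) (p₃ n)).real (goodEvent K w)) ∧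
      ∀ v w : Fin n, v ≠ w →
        (randomHypergraph n (p₂ n) (p₃ n)).real (goodEvent K v ∩ goodEvent K w) ≤
          (randomHypergraph n (p₂ n) (p₃ n)).real (goodEvent K v) *
          (randomHypergraph n (p₂ n) (p₃ n)).real (goodEvent K v) * (1 + δ n) := by
  obtain ⟨c, hc, hlow⟩ := eventually_rpow_le_real_goodEvent hε₀ hε₁ hr hK hI p₂ p₃ hp₂ hp₃
  have hL := tendsto_log_natCast
  have hO₂ : (fun n => (p₂ n : ℝ)) =O[atTop] fun n : ℕ => (n : ℝ) ^ (-1 : ℝ) := by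
    refine Asymptotics.IsBigO.of_bound 1 ?_
    filter_upwards [hp₂] with n h
    rw [Real.rpow_neg_one, Real.norm_of_nonneg (p₂ n).2.1, h,
      Real.norm_of_nonneg (by positivity), div_eq_mul_inv]
    exact mul_le_mul_of_nonneg_right (by linarith) (by positivity)
  have hO₃ : (fun n => (p₃ n : ℝ)) =O[atTop] fun n : ℕ => (n : ℝ) ^ (-1 : ℝ) := by
    refine Asymptotics.IsBigO.of_bound r ?_
    filter_upwards [hp₃, hL.eventually_ge_atTop 1] with n h hn
    rw [Real.rpow_neg_one, Real.norm_of_nonneg (p₃ n).2.1, h,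
      Real.norm_of_nonneg (by positivity), div_eq_mul_inv, mul_inv]
    refine mul_le_mul_of_nonneg_left ?_ hr.le
    exact mul_le_of_le_one_right (by positivity) (inv_le_one_of_one_le₀ hn)
  refine ⟨c, hc, relError K c (fun n => p₂ n) (fun n => p₃ n), tendsto_relError K hc hO₂ hO₃, ?_⟩
  filter_upwards [hlow, hp₂, hp₃, eventually_ge_atTop 2, hL.eventually_ge_atTop r,
    hL.eventually_gt_atTop 0] with n h1 h2 h3 hn hLr hL0
  have hn' : (2 : ℝ) ≤ n := by exact_mod_cast hn
  have hn0 : (0 : ℝ) < n := by linarith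
  have hn1 : (0 : ℝ) ≤ n - 1 := by linarith
  have hq2 : (0 : ℝ) ≤ p₂ n := (p₂ n).2.1
  have hq3 : (0 : ℝ) ≤ p₃ n := (p₃ n).2.1
  have hA : (0 : ℝ) ≤ ⌊K * Real.log n⌋₊ * sizeBound K n * p₂ n +
      ⌊K * Real.log n⌋₊ * ⌊K * Real.log n⌋₊ * sizeBound K n * p₃ n + sizeBound K n / (n - 1) := by
    positivity
  have hB : (0 : ℝ) ≤ (n + n * n) / (⌈5 * Real.log n⌉₊).factorial := by positivity
  have hsymm : ∀ v w : Fin n, (randomHypergraph n (p₂ n) (p₃ n)).real (goodEvent K v) =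
        (randomHypergraph n (p₂ n) (p₃ n)).real (goodEvent K w) := by
    intro v w
    rw [goodEvent_eq_bigEvent hK.le, goodEvent_eq_bigEvent hK.le]
    exact real_bigEvent_eq _ _ _ _ _
  refine ⟨?_, h1, hsymm, ?_⟩
  · unfold relError
    positivity
  intro v w hvw
  refine joint_le_of_rpow_le hn0 (h1 v) hA hB ?_ rfl
  have hnp2 : n * (p₂ n : ℝ) ≤ 1 := by
    rw [h2, mul_div_cancel₀ _ hn0.ne']
    linarith
  have hnp3 : n * (p₃ n : ℝ) ≤ 1 := by
    rw [h3, ← div_div, mul_div_assoc', mul_div_cancel₀ _ hn0.ne', div_le_one hL0]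
    exact hLr
  have h := real_bigEvent_inter_le (p₂ n) (p₃ n) hnp2 hnp3 ⌊K * Real.log n⌋₊ ⌈5 * Real.log n⌉₊
    (sizeBound K n) rfl hvw
  rw [← goodEvent_eq_bigEvent hK.le, ← goodEvent_eq_bigEvent hK.le, hsymm w v] at h
  exact h

end PropagationConnectivity

/-- The edge probabilities need only have the stated values for all large `n`, because for small `n`
the number `r / (n ln n)` may fail to be a probability. -/
theorem mainTheorem6 (ε r : ℝ) (hε₀ : 0 < ε) (hε₁ : ε < 1) (hr : 0 < r)
    (hI : -1 < PropagationConnectivity.rateI ε r)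
    (p₂ p₃ : ℕ → unitInterval)
    (hp₂ : ∀ᶠ n : ℕ in atTop, (p₂ n : ℝ) = (1 - ε) / n)
    (hp₃ : ∀ᶠ n : ℕ in atTop, (p₃ n : ℝ) = r / (n * Real.log n)) :
    Tendsto
      (fun n : ℕ => (PropagationConnectivity.randomHypergraph n (p₂ n) (p₃ n)).real
        {G | 0 < PropagationConnectivity.numGood (PropagationConnectivity.K₀ ε r) G})
      atTop (𝓝 1) ∧
    ∃ δ : ℕ → ℝ, Tendsto δ atTop (𝓝 0) ∧
      ∀ᶠ n : ℕ in atTop, ∀ v₀ v₁ : Fin n, v₀ ≠ v₁ →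
        0 < (PropagationConnectivity.randomHypergraph n (p₂ n) (p₃ n)).real
          (PropagationConnectivity.goodEvent (PropagationConnectivity.K₀ ε r) v₀) ∧
        (cond (PropagationConnectivity.randomHypergraph n (p₂ n) (p₃ n))
            (PropagationConnectivity.goodEvent (PropagationConnectivity.K₀ ε r) v₀)).real
          (PropagationConnectivity.goodEvent (PropagationConnectivity.K₀ ε r) v₁) ≤
        (1 + δ n) * (PropagationConnectivity.randomHypergraph n (p₂ n) (p₃ n)).real
          (PropagationConnectivity.goodEvent (PropagationConnectivity.K₀ ε r) v₀) := by
  have hK : 0 < PropagationConnectivity.K₀ ε r := lt_of_lt_of_le one_pos (le_max_left _ _)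
  obtain ⟨c, hc, δ, hδ, hev⟩ :=
    PropagationConnectivity.eventually_pairs hε₀ hε₁ hr hK hI p₂ p₃ hp₂ hp₃
  refine ⟨?_, δ, hδ, ?_⟩
  · have hlim : Tendsto (fun n : ℕ => 1 - ((n : ℝ) ^ (-c) + δ n)) atTop (𝓝 1) := by
      have h := (((tendsto_rpow_neg_atTop hc).comp
        (tendsto_natCast_atTop_atTop (R := ℝ))).add hδ).const_sub 1
      rw [add_zero, sub_zero] at h
      exact h
    refine tendsto_of_tendsto_of_tendsto_of_le_of_le' hlim tendsto_const_nhds ?_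
      (Eventually.of_forall fun n => measureReal_le_one)
    filter_upwards [hev, eventually_gt_atTop 0] with n ⟨h0, h1, h2, h3⟩ hn
    have hn' : (0 : ℝ) < n := by exact_mod_cast hn
    have hpos := Real.rpow_pos_of_pos hn' (-1 + c)
    have hP := hpos.trans_le (h1 ⟨0, hn⟩)
    have h := PropagationConnectivity.real_iInter_compl_le _ _ hn hP h0 (fun v => h2 v ⟨0, hn⟩)
      (fun v w hvw => (h3 v w hvw).trans_eq (by rw [h2 v ⟨0, hn⟩]))
    have hset : {G | 0 < PropagationConnectivity.numGood (PropagationConnectivity.K₀ ε r) G} =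
        (⋂ v : Fin n, (PropagationConnectivity.goodEvent (PropagationConnectivity.K₀ ε r) v)ᶜ)ᶜ := by
      ext G
      simp only [PropagationConnectivity.numGood, PropagationConnectivity.goodEvent,
        Set.mem_ofPred_eq, Set.mem_compl_iff, Set.mem_iInter, not_forall, not_not]
      exact Set.ncard_pos (Set.toFinite _)
    rw [hset, probReal_compl_eq_one_sub .of_discrete]
    -- Chebyshev's term 1/(nP) vanishes because P ≥ n^(-1+c) gives nP ≥ n^c.
    have hle : 1 / (n * (PropagationConnectivity.randomHypergraph n (p₂ n) (p₃ n)).real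
        (PropagationConnectivity.goodEvent (PropagationConnectivity.K₀ ε r) ⟨0, hn⟩)) ≤
        (n : ℝ) ^ (-c) := by
      have hpow : (n : ℝ) ^ c ≤ n * (PropagationConnectivity.randomHypergraph n (p₂ n) (p₃ n)).real
          (PropagationConnectivity.goodEvent (PropagationConnectivity.K₀ ε r) ⟨0, hn⟩) := by
        refine le_trans (le_of_eq ?_) (mul_le_mul_of_nonneg_left (h1 ⟨0, hn⟩) hn'.le)
        rw [Real.rpow_add hn', Real.rpow_neg_one, ← mul_assoc, mul_inv_cancel₀ hn'.ne', one_mul]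
      rw [Real.rpow_neg hn'.le, ← one_div]
      exact one_div_le_one_div_of_le (Real.rpow_pos_of_pos hn' c) hpow
    linarith
  · filter_upwards [hev, eventually_gt_atTop 0] with n ⟨h0, h1, h2, h3⟩ hn v w hvw
    have hn' : (0 : ℝ) < n := by exact_mod_cast hn
    have hP := (Real.rpow_pos_of_pos hn' (-1 + c)).trans_le (h1 v)
    refine ⟨hP, ?_⟩
    rw [measureReal_def, cond_apply .of_discrete, ENNReal.toReal_mul, ENNReal.toReal_inv,
      ← measureReal_def, ← measureReal_def, ← div_eq_inv_mul, div_le_iff₀ hP]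
    refine (h3 v w hvw).trans (le_of_eq ?_)
    ring
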